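/- Let $\Sigma^+=\{0,1\}^{\mathbb N}$, $\mathbb N=\{1,2,\dots\}$, be the space of one-sided binary sequences, and let $\sigma\colon\Sigma^+\to\Sigma^+$, $\sigma(\{w_i\}_{i\in\mathbb N})=\{w_{i+1}\}_{i\in\mathbb N}$, be the left shift. Let $\theta\in(0,1/4)$ and let $\boldsymbol a=\{a_n\}_{n\ge 0}$ be a strictly decreasing sequence of positive numbers with $$\frac{a_{n+1}}{a_n}=O(\theta^n)\qquad\text{as } n\to+\infty$$ (in particular $a_n\to0$). Let $d_{\boldsymbol a}$ be the metric on $\Sigma^+$ given by $d_{\boldsymbol a}(w,z)=a_m$ for $w\ne z$, where $m$ is the smallest positive integer with $w_m\ne z_m$, and $d_{\boldsymbol a}(z,z)=0$. Let $\operatorname{Lip}(\Sigma^+,d_{\boldsymbol a})$ be the Banach space of real-valued functions that are Lipschitz with respect to $d_{\boldsymbol a}$, with the norm $$\|f\|_{\operatorname{Lip}}=\sup_x|f(x)|+\sup_{x\ne y}\frac{|f(x)-f(y)|}{d_{\boldsymbol a}(x,y)}.$$ For a continuous $f\colon\Sigma^+\to\mathbb R$, a $\sigma$-invariant Borel probability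 measure $\mu$ is called $f$-maximizing if $\int f\,d\nu\le\int f\,d\mu$ for every $\sigma$-invariant Borel probability measure $\nu$. Let $\mathscr{PU}(\sigma)$ be the set of continuous functions $f\colon\Sigma^+\to\mathbb R$ that have a unique $f$-maximizing measure and for which this measure is supported on a periodic orbit of $\sigma$. Let $\operatorname{Lock}_\sigma(\Sigma^+,d_{\boldsymbol a})$ be the set of $f\in\operatorname{Lip}(\Sigma^+,d_{\boldsymbol a})$ that have a unique maximizing measure $\nu$, such that $\nu$ is supported on a periodic orbit of $\sigma$ and $\nu$ is the unique maximizing measure of every $g\in\operatorname{Lip}(\Sigma^+,d_{\boldsymbol a})$ sufficiently close to $f$ in $\|\cdot\|_{\operatorname{Lip}}$. A Borel subset $B$ of a Banach space $V$ is called shy if there is a compactly supported Borel probability measure $\mu$ on $V$ with $\mu(B+v)=0$ for every $v\in V$; a subset $S\subseteq V$ is called prevalent (in the sense of Hunt--Sauer--Yorke) if $V\setminus S$ is contained in a shy Borel subset of $V$. Then $\mathscr{PU}(\sigma)\cap\operatorname{Lip}(\Sigma^+,d_{\boldsymbol a})$ is a prevalent set in $\operatorname{Lip}(\Sigma^+,d_{\boldsymbol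 a})$. Moreover, $\operatorname{Lock}_\sigma(\Sigma^+,d_{\boldsymbol a})$ is a prevalent set in $\operatorname{Lip}(\Sigma^+,d_{\boldsymbol a})$. -/

import Mathlib

open Set Filter Topology MeasureTheory

noncomputable section

/-! ### Prevalence -/

section Prevalence

variable {V : Type*} [AddCommGroup V] [TopologicalSpace V] [MeasurableSpace V]

/-- The measure `μ` is transverse to `B`: every translate of `B` is `μ`-null. -/
def IsTransverse (μ : Measure V) (B : Set V) : Prop :=
  ∀ v : V, μ ((fun x => x + v) '' B) = 0

/-- A Borel set is shy if some compactly supported Borel probability measure is transverse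
to it. (Used with the Borel σ-algebra on `V`.) -/
def IsShyBorel (B : Set V) : Prop :=
  MeasurableSet B ∧
    ∃ μ : Measure V, IsProbabilityMeasure μ ∧ (∃ K : Set V, IsCompact K ∧ μ Kᶜ = 0) ∧
      IsTransverse μ B

/-- A set is prevalent if its complement is contained in a shy Borel set. -/
def IsPrevalent (S : Set V) : Prop :=
  ∃ B : Set V, IsShyBorel B ∧ Sᶜ ⊆ B

end Prevalence

/-! ### Ergodic optimization -/

section Ergodic

variable {X : Type*} [MeasurableSpace X]

/-- `μ` is a `T`-invariant probability measure. -/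
def IsInvariantProb (T : X → X) (μ : Measure X) : Prop :=
  IsProbabilityMeasure μ ∧ MeasurePreserving T μ μ

/-- `μ` is an `f`-maximizing measure. -/
def IsMaximizing (T : X → X) (f : X → ℝ) (μ : Measure X) : Prop :=
  IsInvariantProb T μ ∧ ∀ ν : Measure X, IsInvariantProb T ν → ∫ x, f x ∂ν ≤ ∫ x, f x ∂μ

/-- `μ` is the unique `f`-maximizing measure. -/
def IsUniqueMaximizing (T : X → X) (f : X → ℝ) (μ : Measure X) : Prop :=
  IsMaximizing T f μ ∧ ∀ ν : Measure X, IsMaximizing T f ν → ν = μ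

/-- `μ` is supported on a periodic orbit of `T`. -/
def IsSupportedOnPeriodicOrbit (T : X → X) (μ : Measure X) : Prop :=
  ∃ x ∈ Function.periodicPts T, μ (range fun n : ℕ => T^[n] x)ᶜ = 0

/-- The set of continuous functions that have a unique maximizing measure, this measure being
supported on a periodic orbit. -/
def PU [TopologicalSpace X] (T : X → X) : Set C(X, ℝ) :=
  {f | ∃ μ : Measure X, IsUniqueMaximizing T f μ ∧ IsSupportedOnPeriodicOrbit T μ}

end Ergodic

/-! ### The Banach space of Lipschitz functions on a compact metric space -/

section Lip

/-- The vector space of real-valued Lipschitz functions. -/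
def lipSubmodule (X : Type*) [MetricSpace X] : Submodule ℝ (X → ℝ) where
  carrier := {f | ∃ K, LipschitzWith K f}
  zero_mem' := ⟨0, LipschitzWith.const 0⟩
  add_mem' := by
    rintro f g ⟨K, hf⟩ ⟨L, hg⟩
    exact ⟨K + L, hf.add hg⟩
  smul_mem' := by
    rintro c f ⟨K, hf⟩
    exact ⟨‖c‖₊ * K, (lipschitzWith_smul c).comp hf⟩

/-- The space `Lip(X, d)`; it carries the Lipschitz norm below. -/
def Lip (X : Type*) [MetricSpace X] : Type _ := lipSubmodule X

namespace Lip

variable {X : Type*} [MetricSpace X]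

instance : AddCommGroup (Lip X) := inferInstanceAs (AddCommGroup (lipSubmodule X))

instance : Module ℝ (Lip X) := inferInstanceAs (Module ℝ (lipSubmodule X))

instance : CoeFun (Lip X) (fun _ => X → ℝ) := ⟨fun f => f.1⟩

theorem lipschitz (f : Lip X) : ∃ K, LipschitzWith K f := f.2

/-- A Lipschitz function as a continuous function. -/
def toContinuousMap (f : Lip X) : C(X, ℝ) :=
  ⟨f, f.lipschitz.choose_spec.continuous⟩

/-- The sup-norm. -/
def supNorm (f : Lip X) : ℝ := ⨆ x : X, |f x|

/-- The minimal Lipschitz constant, as the supremum of the difference quotients. (The diagonal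
contributes the value `0 / 0 = 0` only.) -/
def lipConst (f : Lip X) : ℝ := ⨆ p : X × X, |f p.1 - f p.2| / dist p.1 p.2

instance : Norm (Lip X) := ⟨fun f => supNorm f + lipConst f⟩

theorem norm_def (f : Lip X) : ‖f‖ = supNorm f + lipConst f := rfl

theorem bddAbove_sup [CompactSpace X] (f : Lip X) : BddAbove (range fun x : X => |f x|) :=
  (isCompact_range f.toContinuousMap.continuous.abs).bddAbove

theorem bddAbove_lip (f : Lip X) :
    BddAbove (range fun p : X × X => |f p.1 - f p.2| / dist p.1 p.2) := by
  obtain ⟨K, hK⟩ := f.lipschitz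
  refine ⟨K, ?_⟩
  rintro _ ⟨p, rfl⟩
  have h := hK.dist_le_mul p.1 p.2
  rw [Real.dist_eq] at h
  exact div_le_of_le_mul₀ dist_nonneg K.2 h

theorem supNorm_nonneg (f : Lip X) : 0 ≤ supNorm f := Real.iSup_nonneg fun _ => abs_nonneg _

theorem lipConst_nonneg (f : Lip X) : 0 ≤ lipConst f :=
  Real.iSup_nonneg fun _ => div_nonneg (abs_nonneg _) dist_nonneg

theorem core [CompactSpace X] : NormedSpace.Core ℝ (Lip X) where
  norm_nonneg f := add_nonneg f.supNorm_nonneg f.lipConst_nonneg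
  norm_smul c f := by
    have h1 : supNorm (c • f) = |c| * supNorm f := by
      unfold supNorm
      rw [Real.mul_iSup_of_nonneg (abs_nonneg c)]
      exact iSup_congr fun x => abs_mul c (f x)
    have h2 : lipConst (c • f) = |c| * lipConst f := by
      unfold lipConst
      rw [Real.mul_iSup_of_nonneg (abs_nonneg c)]
      refine iSup_congr fun p => ?_
      have : (c • f) p.1 - (c • f) p.2 = c * (f p.1 - f p.2) := (mul_sub c _ _).symm
      rw [this, abs_mul, mul_div_assoc]
    rw [norm_def, norm_def, h1, h2, Real.norm_eq_abs, mul_add]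
  norm_triangle f g := by
    have h1 : supNorm (f + g) ≤ supNorm f + supNorm g :=
      Real.iSup_le (fun x => (abs_add_le (f x) (g x)).trans
        (add_le_add (le_ciSup f.bddAbove_sup x) (le_ciSup g.bddAbove_sup x)))
        (add_nonneg f.supNorm_nonneg g.supNorm_nonneg)
    have h2 : lipConst (f + g) ≤ lipConst f + lipConst g := by
      refine Real.iSup_le (fun p => ?_) (add_nonneg f.lipConst_nonneg g.lipConst_nonneg)
      refine le_trans ?_ (add_le_add (le_ciSup f.bddAbove_lip p) (le_ciSup g.bddAbove_lip p))
      have : (f + g) p.1 - (f + g) p.2 = (f p.1 - f p.2) + (g p.1 - g p.2) :=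
        add_sub_add_comm _ _ _ _
      rw [this, ← add_div]
      exact div_le_div_of_nonneg_right (abs_add_le _ _) dist_nonneg
    rw [norm_def, norm_def, norm_def]
    linarith
  norm_eq_zero_iff f := by
    constructor
    · intro h
      rw [norm_def] at h
      have h0 : supNorm f = 0 := by linarith [f.supNorm_nonneg, f.lipConst_nonneg]
      refine Subtype.ext (funext fun x => ?_)
      have hx : |f x| ≤ 0 := h0 ▸ le_ciSup f.bddAbove_sup x
      exact abs_nonpos_iff.1 hx
    · rintro rfl
      have h1 : supNorm (0 : Lip X) = 0 := by
        have : ∀ x : X, |(0 : Lip X) x| = 0 := fun x => abs_zero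
        simp [supNorm, this]
      have h2 : lipConst (0 : Lip X) = 0 := by
        have : ∀ p : X × X, |(0 : Lip X) p.1 - (0 : Lip X) p.2| / dist p.1 p.2 = 0 := by
          intro p
          have : (0 : Lip X) p.1 - (0 : Lip X) p.2 = 0 := sub_zero (0 : ℝ)
          rw [this, abs_zero, zero_div]
        simp [lipConst, this]
      rw [norm_def, h1, h2, add_zero]

instance [CompactSpace X] : NormedAddCommGroup (Lip X) :=
  NormedAddCommGroup.ofCore core

instance [CompactSpace X] : NormedSpace ℝ (Lip X) := NormedSpace.ofCore core

instance [CompactSpace X] : MeasurableSpace (Lip X) := borel (Lip X)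

instance [CompactSpace X] : BorelSpace (Lip X) := ⟨rfl⟩

end Lip

/-- The set of Lipschitz functions with the locking property: there is a unique maximizing
measure, it is supported on a periodic orbit, and it is the unique maximizing measure of all
functions that are sufficiently close in the Lipschitz norm. -/
def Lock {X : Type*} [MetricSpace X] [CompactSpace X] [MeasurableSpace X] (T : X → X) :
    Set (Lip X) :=
  {f | ∃ ν : Measure X, IsUniqueMaximizing T f ν ∧ IsSupportedOnPeriodicOrbit T ν ∧
    ∀ᶠ g : Lip X in 𝓝 f, IsUniqueMaximizing T g ν}

end Lip

/-! ### The one-sided full shift on two symbols -/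

section Shift

/-- A strictly decreasing sequence of positive numbers converging to zero. -/
structure MetricSeq where
  toFun : ℕ → ℝ
  strictAnti : StrictAnti toFun
  pos : ∀ n, 0 < toFun n
  tendsto : Tendsto toFun atTop (𝓝 0)

/-- A strictly decreasing sequence of positive numbers with `a (n + 1) / a n = O(θ ^ n)`,
`0 < θ < 1 / 4`, converges to zero. -/
def MetricSeq.ofDecay (a : ℕ → ℝ) (ha : StrictAnti a) (hpos : ∀ n, 0 < a n)
    {θ : ℝ} (hθ : θ ∈ Ioo (0 : ℝ) (1 / 4))
    (hdecay : (fun n : ℕ => a (n + 1) / a n) =O[atTop] (fun n : ℕ => θ ^ n)) : MetricSeq where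
  toFun := a
  strictAnti := ha
  pos := hpos
  tendsto := by
    have h0 : Tendsto (fun n : ℕ => a (n + 1) / a n) atTop (𝓝 0) :=
      hdecay.trans_tendsto
        (tendsto_pow_atTop_nhds_zero_of_lt_one hθ.1.le (by linarith [hθ.2]))
    refine (summable_of_ratio_test_tendsto_lt_one (l := 0) one_pos
      (Eventually.of_forall fun n => (hpos n).ne') (h0.congr fun n => ?_)).tendsto_atTop_zero
    rw [Real.norm_of_nonneg (hpos _).le, Real.norm_of_nonneg (hpos _).le]

/-- The space `Σ⁺` of one-sided binary sequences, with the metric `d_a`. The entry with index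
`i : ℕ` is the `(i + 1)`-st symbol of the sequence. -/
def FullShift (_a : MetricSeq) : Type := ℕ → Bool

namespace FullShift

variable {a : MetricSeq}

/-- The left shift. -/
def shift (a : MetricSeq) (w : FullShift a) : FullShift a := fun i => w (i + 1)

/-- The product topology. -/
instance : TopologicalSpace (FullShift a) := inferInstanceAs (TopologicalSpace (ℕ → Bool))

instance : CompactSpace (FullShift a) := inferInstanceAs (CompactSpace (ℕ → Bool))

/-- The product σ-algebra; it is the Borel σ-algebra. -/
instance : MeasurableSpace (FullShift a) := inferInstanceAs (MeasurableSpace (ℕ → Bool))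

instance : BorelSpace (FullShift a) := inferInstanceAs (BorelSpace (ℕ → Bool))

open Classical in
/-- `d_a(w, z) = a_m`, where the `m`-th symbol (`m ≥ 1`) is the first one at which `w` and `z`
differ. As symbols are indexed from `0`, this is `m = firstDiff w z + 1`. -/
instance : Dist (FullShift a) :=
  ⟨fun w z => if w = z then 0
    else a.toFun (PiNat.firstDiff (E := fun _ => Bool) w z + 1)⟩

theorem dist_self' (w : FullShift a) : dist w w = 0 := if_pos rfl

theorem dist_of_ne {w z : FullShift a} (h : w ≠ z) :
    dist w z = a.toFun (PiNat.firstDiff (E := fun _ => Bool) w z + 1) := if_neg h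

theorem dist_lt_iff {w z : FullShift a} (n : ℕ) :
    dist w z < a.toFun n ↔ ∀ i < n, w i = z i := by
  by_cases h : w = z
  · subst h
    simp [dist_self', a.pos n]
  · rw [dist_of_ne h, a.strictAnti.lt_iff_gt]
    constructor
    · intro hn i hi
      exact PiNat.apply_eq_of_lt_firstDiff (E := fun _ => Bool) (by omega)
    · intro hn
      by_contra hlt
      exact PiNat.apply_firstDiff_ne (E := fun _ => Bool) h (hn _ (by omega))

theorem dist_triangle' (x y z : FullShift a) : dist x z ≤ dist x y + dist y z := by
  by_cases hxz : x = z
  · subst hxz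
    rw [dist_self']
    by_cases hxy : x = y
    · subst hxy; simp [dist_self']
    · rw [dist_of_ne hxy, dist_of_ne (Ne.symm hxy)]
      exact add_nonneg (a.pos _).le (a.pos _).le
  by_cases hxy : x = y
  · subst hxy; simp [dist_self']
  by_cases hyz : y = z
  · subst hyz; simp [dist_self']
  rw [dist_of_ne hxz, dist_of_ne hxy, dist_of_ne hyz]
  have h := PiNat.min_firstDiff_le (E := fun _ => Bool) x y z hxz
  rcases min_le_iff.1 h with h | h
  · have := a.strictAnti.antitone (Nat.succ_le_succ h)
    linarith [a.pos (PiNat.firstDiff (E := fun _ => Bool) y z + 1)]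
  · have := a.strictAnti.antitone (Nat.succ_le_succ h)
    linarith [a.pos (PiNat.firstDiff (E := fun _ => Bool) x y + 1)]

theorem isOpen_iff_dist' (s : Set (FullShift a)) :
    IsOpen s ↔ ∀ x ∈ s, ∃ ε > 0, ∀ y, dist x y < ε → y ∈ s := by
  constructor
  · intro hs x hx
    obtain ⟨v, ⟨y, n, rfl⟩, hxv, hvs⟩ :=
      (PiNat.isTopologicalBasis_cylinders fun _ => Bool).exists_subset_of_mem_open hx hs
    refine ⟨a.toFun n, a.pos n, fun z hz => hvs ?_⟩
    rw [dist_lt_iff] at hz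
    intro i hi
    rw [← hz i hi]
    exact hxv i hi
  · intro h
    rw [isOpen_iff_mem_nhds]
    intro x hx
    obtain ⟨ε, hε, hs⟩ := h x hx
    obtain ⟨n, hn⟩ := (a.tendsto.eventually (gt_mem_nhds hε)).exists
    refine mem_of_superset ((PiNat.isOpen_cylinder (fun _ => Bool) x n).mem_nhds
      (PiNat.self_mem_cylinder x n)) fun y hy => hs y (lt_trans ?_ hn)
    rw [dist_lt_iff]
    exact fun i hi => (hy i hi).symm

/-- The metric `d_a`; it induces the product topology. -/
instance : MetricSpace (FullShift a) :=
  MetricSpace.ofDistTopology dist dist_self'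
    (fun x y => by
      by_cases h : x = y
      · subst h; rfl
      · rw [dist_of_ne h, dist_of_ne (Ne.symm h)]
        exact congrArg (fun n => a.toFun (n + 1))
          (PiNat.firstDiff_comm (E := fun _ => Bool) x y))
    dist_triangle' isOpen_iff_dist'
    (fun x y h => by
      by_contra hne
      rw [dist_of_ne hne] at h
      exact (a.pos _).ne' h)

end FullShift

end Shift

end

/-! Perturb a given `f` by the random series `noise`: every cylinder of length `n + 1` gets an
independent uniform coefficient in the unit interval, scaled by `ρ ^ n * a (n + 1)` with `4 * θ < ρ
< 1`. The scaling makes the series converge in the Lipschitz norm, uniformly in the coefficients, so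
its law has compact support. It remains to see that almost every perturbation has the locking
property.

Fix a level `n` and view words of length `n + 1` as the edges of a graph on the `2 ^ n` words of
length `n`. A function `F` weighs an edge by its value at one point of the cylinder, with error `O(a
(n + 2))`. If one simple cycle beats every other in mean weight by a suitable multiple of `a (n +
2)`, the periodic orbit reading it is uniquely maximizing for all functions near `F`
(`isUniqueMaximizing_of_dominant`, `mem_lock_of_no_nearTie`). The sum of `F` along an orbit splits
into a walk sum, bounded because simple cycles have nonpositive normalized weight, and an error
controlled by shadowing and the summability of `a`.

Dominance can fail only through a near tie at some edge (`exists_dominant_cycle`). With the other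
weights frozen, near ties at `e` confine the weight of `e` to an interval of length `O(2 ^ n * a (n
+ 2))` (`IsNearTie.sub_le`), while its coefficient moves it at speed `ρ ^ n * a (n + 1)`. Summing
over `2 ^ (n + 1)` edges bounds the failure probability by a constant times `(4 * θ / ρ) ^ n`, for
every large `n`; hence it is `0`. Functions with the locking property lie in `PU`, so both claims
follow. -/

/-! ### Cycles in finite directed multigraphs -/

section Graph

variable {E V : Type*} {s t : E → V}

/-- The edges `γ 0, …, γ (q - 1)` form a walk, and `γ q` is an edge starting at its end point. -/
def IsEdgeWalk (s t : E → V) (γ : ℕ → E) (q : ℕ) : Prop :=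
  ∀ i < q, t (γ i) = s (γ (i + 1))

/-- The edges `γ 0, …, γ (q - 1)` form a closed walk. -/
structure IsEdgeCycle (s t : E → V) (γ : ℕ → E) (q : ℕ) : Prop where
  pos : 0 < q
  walk : IsEdgeWalk s t γ q
  closed : s (γ q) = s (γ 0)

/-- A closed walk is simple if it visits no vertex twice. -/
structure IsSimpleEdgeCycle (s t : E → V) (γ : ℕ → E) (q : ℕ) : Prop
    extends IsEdgeCycle s t γ q where
  inj : ∀ i < q, ∀ j < q, s (γ i) = s (γ j) → i = j

/-- Cutting a closed piece out of a walk. -/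
theorem IsEdgeWalk.excise {γ : ℕ → E} {q i j : ℕ} (h : IsEdgeWalk s t γ q) (hij : i < j)
    (hjq : j ≤ q) (heq : s (γ i) = s (γ j)) :
    ∃ γ₁ γ₂ : ℕ → E, IsEdgeCycle s t γ₁ (j - i) ∧ IsEdgeWalk s t γ₂ (q - (j - i)) ∧
      s (γ₂ 0) = s (γ 0) ∧ s (γ₂ (q - (j - i))) = s (γ q) ∧
      ∀ w : E → ℝ, ∑ k ∈ Finset.range q, w (γ k) =
        ∑ k ∈ Finset.range (j - i), w (γ₁ k) + ∑ k ∈ Finset.range (q - (j - i)), w (γ₂ k) := by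
  refine ⟨fun k => γ (i + k), fun k => if k < i then γ k else γ (k + (j - i)),
    ⟨by omega, fun k hk => h (i + k) (by omega), ?_⟩, ?_, ?_, ?_, ?_⟩
  · simp only [add_zero]
    rw [show i + (j - i) = j by omega, heq]
  · intro k hk
    dsimp only
    rcases lt_trichotomy (k + 1) i with h1 | h1 | h1
    · rw [if_pos (by omega), if_pos h1]
      exact h k (by omega)
    · rw [if_pos (by omega), if_neg (by omega), h k (by omega),
        show k + 1 + (j - i) = j by omega, h1, heq]
    · rw [if_neg (by omega), if_neg (by omega), h _ (by omega)]
      congr 2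
      omega
  · dsimp only
    split_ifs with h0
    · rfl
    · have : i = 0 := by omega
      subst this
      rw [heq]
      congr 2
      omega
  · dsimp only
    rw [if_neg (by omega)]
    congr 2
    omega
  · intro w
    obtain ⟨d, rfl⟩ : ∃ d, j = i + d := ⟨j - i, by omega⟩
    obtain ⟨r, rfl⟩ : ∃ r, q = i + d + r := ⟨q - (i + d), by omega⟩
    rw [show i + d - i = d by omega, show i + d + r - d = i + r by omega,
      Finset.sum_range_add, Finset.sum_range_add, Finset.sum_range_add]
    have e1 : ∑ k ∈ Finset.range i, w (if k < i then γ k else γ (k + d)) =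
        ∑ k ∈ Finset.range i, w (γ k) :=
      Finset.sum_congr rfl fun k hk => by rw [if_pos (Finset.mem_range.1 hk)]
    have e2 : ∑ k ∈ Finset.range r, w (if i + k < i then γ (i + k) else γ (i + k + d)) =
        ∑ k ∈ Finset.range r, w (γ (i + d + k)) :=
      Finset.sum_congr rfl fun k _ => by
        rw [if_neg (by omega), show i + k + d = i + d + k by omega]
    rw [e1, e2]
    ring

/-- A closed walk that is not simple splits into two shorter ones. -/
theorem IsEdgeCycle.exists_split {γ : ℕ → E} {q : ℕ} (h : IsEdgeCycle s t γ q)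
    (hs : ¬ IsSimpleEdgeCycle s t γ q) :
    ∃ (γ₁ γ₂ : ℕ → E) (q₁ q₂ : ℕ), IsEdgeCycle s t γ₁ q₁ ∧ IsEdgeCycle s t γ₂ q₂ ∧
      q₁ + q₂ = q ∧ ∀ w : E → ℝ, ∑ k ∈ Finset.range q, w (γ k) =
        ∑ k ∈ Finset.range q₁, w (γ₁ k) + ∑ k ∈ Finset.range q₂, w (γ₂ k) := by
  have : ∃ i j, i < j ∧ j < q ∧ s (γ i) = s (γ j) := by
    by_contra! hc
    refine hs ⟨h, fun i hi j hj hij => ?_⟩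
    rcases lt_trichotomy i j with h1 | h1 | h1
    · exact (hc i j h1 hj hij).elim
    · exact h1
    · exact (hc j i h1 hi hij.symm).elim
  obtain ⟨i, j, hij, hjq, heq⟩ := this
  obtain ⟨γ₁, γ₂, h1, h2, h3, h4, h5⟩ := h.walk.excise hij hjq.le heq
  exact ⟨γ₁, γ₂, j - i, q - (j - i), h1, ⟨by omega, h2, by rw [h4, h3, h.closed]⟩,
    by omega, h5⟩

/-- If the weights of all simple closed walks are nonpositive, so are those of all closed
walks. -/
theorem IsEdgeCycle.sum_nonpos {w : E → ℝ}
    (hw : ∀ γ q, IsSimpleEdgeCycle s t γ q → ∑ k ∈ Finset.range q, w (γ k) ≤ 0) {γ : ℕ → E}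
    {q : ℕ} (h : IsEdgeCycle s t γ q) : ∑ k ∈ Finset.range q, w (γ k) ≤ 0 := by
  induction q using Nat.strong_induction_on generalizing γ with
  | _ q ih =>
    by_cases hs : IsSimpleEdgeCycle s t γ q
    · exact hw γ q hs
    · obtain ⟨γ₁, γ₂, q₁, q₂, h1, h2, hq, hsum⟩ := h.exists_split hs
      rw [hsum]
      have := ih q₁ (by have := h2.pos; omega) h1
      have := ih q₂ (by have := h1.pos; omega) h2
      linarith

theorem exists_lt_vertex_eq [Fintype V] (s : E → V) (γ : ℕ → E) {q : ℕ}
    (hq : Fintype.card V < q) : ∃ i j, i < j ∧ j < q ∧ s (γ i) = s (γ j) := by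
  obtain ⟨i, j, hij, heq⟩ := Fintype.exists_ne_map_eq_of_card_lt
    (fun i : Fin q => s (γ i)) (by simpa using hq)
  rcases lt_or_gt_of_ne hij with h | h
  · exact ⟨i, j, h, j.2, heq⟩
  · exact ⟨j, i, h, i.2, heq.symm⟩

theorem IsSimpleEdgeCycle.length_le [Fintype V] {γ : ℕ → E} {q : ℕ}
    (h : IsSimpleEdgeCycle s t γ q) : q ≤ Fintype.card V := by
  by_contra! hq
  obtain ⟨i, j, hij, hj, heq⟩ := exists_lt_vertex_eq s γ hq
  exact hij.ne (h.inj i (hij.trans hj) j hj heq)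

/-- If the weights of all simple closed walks are nonpositive, then the weights of all walks are
bounded. -/
theorem IsEdgeWalk.sum_le [Fintype V] [Fintype E] {w : E → ℝ}
    (hw : ∀ γ q, IsSimpleEdgeCycle s t γ q → ∑ k ∈ Finset.range q, w (γ k) ≤ 0) {γ : ℕ → E}
    {q : ℕ} (h : IsEdgeWalk s t γ q) :
    ∑ k ∈ Finset.range q, w (γ k) ≤ Fintype.card V * ∑ e, |w e| := by
  induction q using Nat.strong_induction_on generalizing γ with
  | _ q ih =>
    -- Short walks satisfy the bound term by term. A longer one repeats a vertex, and removing the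
    -- closed piece, of nonpositive weight, does not lower the sum.
    rcases le_or_gt q (Fintype.card V) with hq | hq
    · calc ∑ k ∈ Finset.range q, w (γ k) ≤ ∑ _k ∈ Finset.range q, ∑ e, |w e| :=
            Finset.sum_le_sum fun k _ => (le_abs_self _).trans
              (Finset.single_le_sum (f := fun e => |w e|) (fun e _ => abs_nonneg _)
                (Finset.mem_univ (γ k)))
        _ = q * ∑ e, |w e| := by simp
        _ ≤ Fintype.card V * ∑ e, |w e| := by
            have : (0 : ℝ) ≤ ∑ e, |w e| := Finset.sum_nonneg fun e _ => abs_nonneg _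
            gcongr
    · obtain ⟨i, j, hij, hj, heq⟩ := exists_lt_vertex_eq s γ hq
      obtain ⟨γ₁, γ₂, h1, h2, -, -, h5⟩ := h.excise hij hj.le heq
      rw [h5]
      have := h1.sum_nonpos hw
      have := ih _ (by omega) h2
      linarith

theorem IsSimpleEdgeCycle.edge_inj {γ : ℕ → E} {q : ℕ} (h : IsSimpleEdgeCycle s t γ q) {i j : ℕ}
    (hi : i < q) (hj : j < q) (hij : γ i = γ j) : i = j :=
  h.inj i hi j hj (congrArg s hij)

/-- The edge that follows an edge of a closed walk. -/
theorem IsEdgeCycle.exists_succ {γ : ℕ → E} {q : ℕ} (h : IsEdgeCycle s t γ q) {i : ℕ}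
    (hi : i < q) : ∃ j < q, t (γ i) = s (γ j) := by
  rcases (Nat.succ_le_of_lt hi).lt_or_eq with h1 | h1
  · exact ⟨i + 1, h1, h.walk i hi⟩
  · refine ⟨0, h.pos, ?_⟩
    rw [h.walk i hi, ← h.closed]
    exact congrArg (fun k => s (γ k)) h1

/-- A simple closed walk that contains all edges of another closed walk has no other edges. -/
theorem IsSimpleEdgeCycle.mem_of_subset {γ γ' : ℕ → E} {q q' : ℕ} (h : IsEdgeCycle s t γ q)
    (h' : IsSimpleEdgeCycle s t γ' q') (hsub : ∀ i < q, ∃ j < q', γ' j = γ i) :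
    ∀ j < q', ∃ i < q, γ i = γ' j := by
  -- A simple closed walk has only one edge out of each vertex, so from a common edge both walks
  -- continue with the same edge.
  have step : ∀ j < q', ∀ j₁ < q', t (γ' j) = s (γ' j₁) → (∃ i < q, γ i = γ' j) →
      ∃ i < q, γ i = γ' j₁ := by
    rintro j hj j₁ hj₁ hjj ⟨i, hi, hij⟩
    obtain ⟨i₁, hi₁, hi₁'⟩ := h.exists_succ hi
    obtain ⟨j₂, hj₂, hj₂'⟩ := hsub i₁ hi₁
    have : j₂ = j₁ := h'.inj _ hj₂ _ hj₁ (by rw [hj₂', ← hi₁', hij, hjj])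
    exact ⟨i₁, hi₁, by rw [← hj₂', this]⟩
  have up : ∀ j₀ < q', (∃ i < q, γ i = γ' j₀) → ∀ j, j₀ ≤ j → j < q' → ∃ i < q, γ i = γ' j := by
    intro j₀ hj₀ h0 j hj
    induction j, hj using Nat.le_induction with
    | base => exact fun _ => h0
    | succ j hj ih =>
      exact fun hlt => step j (by omega) (j + 1) hlt (h'.walk j (by omega)) (ih (by omega))
  obtain ⟨j₀, hj₀, hj₀'⟩ := hsub 0 h.pos
  -- Going on to the last edge and wrapping around to the first also reaches the edges before `j₀`.
  have hlast := up j₀ hj₀ ⟨0, h.pos, hj₀'.symm⟩ (q' - 1) (by omega) (by omega)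
  have hfirst := step (q' - 1) (by omega) 0 h'.pos (by
    rw [h'.walk _ (by omega), ← h'.closed, Nat.sub_add_cancel h'.pos]) hlast
  exact fun j hj => up 0 h'.pos hfirst j (Nat.zero_le j) hj

/-- Simple closed walks with the same edges have the same weight. -/
theorem IsSimpleEdgeCycle.sum_eq_of_subset {γ γ' : ℕ → E} {q q' : ℕ}
    (h : IsSimpleEdgeCycle s t γ q) (h' : IsSimpleEdgeCycle s t γ' q')
    (hsub : ∀ i < q, ∃ j < q', γ' j = γ i) (w : E → ℝ) :
    ∑ k ∈ Finset.range q, w (γ k) = ∑ k ∈ Finset.range q', w (γ' k) := by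
  classical
  have hsub' := IsSimpleEdgeCycle.mem_of_subset h.toIsEdgeCycle h' hsub
  rw [← Finset.sum_image (f := w) (g := γ) (s := Finset.range q),
    ← Finset.sum_image (f := w) (g := γ') (s := Finset.range q')]
  · congr 1
    ext e
    simp only [Finset.mem_image, Finset.mem_range]
    constructor
    · rintro ⟨i, hi, rfl⟩
      exact hsub i hi
    · rintro ⟨i, hi, rfl⟩
      exact hsub' i hi
  · intro i hi j hj hij
    exact h'.edge_inj (by simpa using hi) (by simpa using hj) hij
  · intro i hi j hj hij
    exact h.edge_inj (by simpa using hi) (by simpa using hj) hij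

end Graph

/-! ### Isolation of the optimal mean weight -/

section Isolation

variable {E : Type*} [Fintype E]

/-- The mean of the weight `W` with respect to the multiplicities `k`. -/
noncomputable def meanWeight (W : E → ℝ) (k : E → ℕ) : ℝ := (∑ e, k e * W e) / ∑ e, (k e : ℝ)

/-- The optimal mean weight over `Z` is attained at a vector charging `e`, and exceeds by at most
`δ` the mean weight of a vector not charging `e`. -/
def IsNearTie (Z : Set (E → ℕ)) (δ : ℝ) (e : E) (W : E → ℝ) : Prop :=
  ∃ k ∈ Z, ∃ k' ∈ Z, 0 < k e ∧ k' e = 0 ∧ (∀ l ∈ Z, meanWeight W l ≤ meanWeight W k) ∧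
    meanWeight W k ≤ meanWeight W k' + δ

theorem continuous_meanWeight (k : E → ℕ) : Continuous fun W : E → ℝ => meanWeight W k := by
  unfold meanWeight
  fun_prop

/-- A finite union over the pairs of witnesses of sets cut out by weak inequalities. It supplies the
measurability of the near-tie event. -/
theorem isClosed_isNearTie {Z : Set (E → ℕ)} (hZ : Z.Finite) (δ : ℝ) (e : E) :
    IsClosed {W : E → ℝ | IsNearTie Z δ e W} := by
  have : {W : E → ℝ | IsNearTie Z δ e W} = ⋃ k ∈ Z, ⋃ k' ∈ Z,
      {W | 0 < k e ∧ k' e = 0 ∧ (∀ l ∈ Z, meanWeight W l ≤ meanWeight W k) ∧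
        meanWeight W k ≤ meanWeight W k' + δ} := by
    ext W
    simp only [IsNearTie, mem_ofPred_eq, mem_iUnion, exists_prop]
  rw [this]
  refine hZ.isClosed_biUnion fun k _ => hZ.isClosed_biUnion fun k' _ => ?_
  refine isClosed_const.and (isClosed_const.and (IsClosed.and ?_ ?_))
  · simp only [ofPred_forall]
    exact isClosed_biInter fun l _ =>
      isClosed_le (continuous_meanWeight l) (continuous_meanWeight k)
  · exact isClosed_le (continuous_meanWeight k) ((continuous_meanWeight k').add continuous_const)

/-- Near ties can be destroyed by changing a single weight: those values of the weight of `e`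
that lead to a near tie at `e` lie in a short interval. -/
theorem IsNearTie.sub_le {Z : Set (E → ℕ)} {N : ℕ} (hN : ∀ k ∈ Z, ∑ e, k e ≤ N) {δ : ℝ}
    {e : E} {W W' : E → ℝ} (hWW' : ∀ e' ≠ e, W e' = W' e') (h : IsNearTie Z δ e W)
    (h' : IsNearTie Z δ e W') (hle : W e ≤ W' e) : W' e - W e ≤ N * δ := by
  obtain ⟨k, hk, -, -, hke, -, hopt, -⟩ := h
  obtain ⟨k₁, -, k₁', hk₁', -, hk₁'e, hopt', hδ⟩ := h'
  -- The competitor that avoids `e` does not feel the change of the weight of `e`.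
  have h1 : meanWeight W' k₁' = meanWeight W k₁' := by
    unfold meanWeight
    congr 1
    refine Finset.sum_congr rfl fun e' _ => ?_
    by_cases he : e' = e
    · subst he; simp [hk₁'e]
    · rw [hWW' e' he]
  have hpos : 0 < ∑ e, (k e : ℝ) :=
    Finset.sum_pos' (fun e _ => Nat.cast_nonneg _) ⟨e, Finset.mem_univ e, by exact_mod_cast hke⟩
  have hkN : ∑ e, (k e : ℝ) ≤ N := by exact_mod_cast hN k hk
  -- The optimum for `W` charges `e` at least once with total multiplicity at most `N`, so its mean
  -- rises by at least a fraction `1 / N` of the increase. It may not overtake the competitor by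
  -- more than `δ`.
  have h2 : meanWeight W k + (W' e - W e) / N ≤ meanWeight W' k := by
    have hsum : ∑ e', k e' * W' e' = ∑ e', k e' * W e' + k e * (W' e - W e) := by
      rw [← sub_eq_iff_eq_add', ← Finset.sum_sub_distrib, Finset.sum_eq_single e]
      · ring
      · intro e' _ he'
        rw [hWW' e' he', sub_self]
      · simp
    unfold meanWeight
    rw [hsum, add_div]
    gcongr
    have : (1 : ℝ) ≤ k e := by exact_mod_cast hke
    nlinarith
  have h3 := hopt k₁' hk₁'
  have h4 := hopt' k hk
  have hNpos : (0 : ℝ) < N := hpos.trans_le hkN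
  have h5 : (W' e - W e) / N ≤ δ := by linarith
  rwa [div_le_iff₀ hNpos, mul_comm] at h5

end Isolation

/-! ### Edge multiplicities and the dominant cycle -/

section Counts

variable {E V : Type*} {s t : E → V}

open Classical in
/-- The multiplicities of the edges in a walk. -/
noncomputable def edgeCount (γ : ℕ → E) (q : ℕ) (e : E) : ℕ :=
  ((Finset.range q).filter fun i => γ i = e).card

theorem edgeCount_pos {γ : ℕ → E} {q : ℕ} {e : E} :
    0 < edgeCount γ q e ↔ ∃ i < q, γ i = e := by
  classical
  simp [edgeCount, Finset.card_pos, Finset.Nonempty]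

variable [Fintype E]

theorem sum_edgeCount_mul (γ : ℕ → E) (q : ℕ) (W : E → ℝ) :
    ∑ e, edgeCount γ q e * W e = ∑ i ∈ Finset.range q, W (γ i) := by
  classical
  rw [← Finset.sum_fiberwise (Finset.range q) γ]
  refine Finset.sum_congr rfl fun e _ => ?_
  rw [Finset.sum_congr rfl (g := fun _ => W e)
    fun i hi => by rw [(Finset.mem_filter.1 hi).2], Finset.sum_const, nsmul_eq_mul]
  unfold edgeCount
  congr!

theorem sum_edgeCount (γ : ℕ → E) (q : ℕ) : ∑ e, (edgeCount γ q e : ℝ) = q := by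
  simpa using sum_edgeCount_mul γ q fun _ => 1

theorem meanWeight_edgeCount (W : E → ℝ) (γ : ℕ → E) (q : ℕ) :
    meanWeight W (edgeCount γ q) = (∑ i ∈ Finset.range q, W (γ i)) / q := by
  rw [meanWeight, sum_edgeCount_mul, sum_edgeCount]

/-- The multiplicities of the closed walks of length at most `N`. -/
def cycleCounts (s t : E → V) (N : ℕ) : Set (E → ℕ) :=
  {k | ∃ γ q, IsEdgeCycle s t γ q ∧ q ≤ N ∧ k = edgeCount γ q}

theorem sum_le_of_mem_cycleCounts {N : ℕ} {k : E → ℕ} (hk : k ∈ cycleCounts s t N) :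
    ∑ e, k e ≤ N := by
  obtain ⟨γ, q, -, hq, rfl⟩ := hk
  have := sum_edgeCount γ q
  have : ∑ e, edgeCount γ q e = q := by exact_mod_cast this
  omega

theorem finite_cycleCounts (s t : E → V) (N : ℕ) : (cycleCounts s t N).Finite := by
  refine (Set.Finite.pi' fun _ : E => Set.finite_Iic N).subset fun k hk e => ?_
  exact (Finset.single_le_sum (fun _ _ => Nat.zero_le _) (Finset.mem_univ e)).trans
    (sum_le_of_mem_cycleCounts hk)

/-- In the absence of near ties there is a simple closed walk that beats all other simple closed
walks by a definite amount. -/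
theorem exists_dominant_cycle [Fintype V] {W : E → ℝ} {δ : ℝ}
    (hne : ∃ γ q, IsSimpleEdgeCycle s t γ q)
    (hW : ∀ e, ¬ IsNearTie (cycleCounts s t (Fintype.card V)) δ e W) :
    ∃ c p, IsSimpleEdgeCycle s t c p ∧ ∀ γ q, IsSimpleEdgeCycle s t γ q →
      (∀ i < q, ∃ j < p, c j = γ i) ∨
      (∑ i ∈ Finset.range q, W (γ i)) / q ≤ (∑ i ∈ Finset.range p, W (c i)) / p - δ := by
  obtain ⟨γ₀, q₀, h₀⟩ := hne
  set Z := cycleCounts s t (Fintype.card V)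
  have mem : ∀ γ q, IsEdgeCycle s t γ q → q ≤ Fintype.card V → edgeCount γ q ∈ Z :=
    fun γ q h hq => ⟨γ, q, h, hq, rfl⟩
  obtain ⟨k, hk, hkmax⟩ := (finite_cycleCounts s t (Fintype.card V)).exists_maximalFor
    (meanWeight W) _ ⟨_, mem _ _ h₀.toIsEdgeCycle h₀.length_le⟩
  have hkmax' : ∀ l ∈ Z, meanWeight W l ≤ meanWeight W k := fun l hl =>
    (le_total (meanWeight W l) (meanWeight W k)).elim id fun h => hkmax hl h
  -- A shortest optimal closed walk is simple: otherwise it splits into two shorter ones, both of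
  -- strictly smaller mean, and so is not optimal.
  have hex : ∃ p, ∃ c, IsEdgeCycle s t c p ∧ p ≤ Fintype.card V ∧
      meanWeight W k ≤ meanWeight W (edgeCount c p) := by
    obtain ⟨γ, q, h, hq, rfl⟩ := hk
    exact ⟨q, γ, h, hq, le_rfl⟩
  classical
  obtain ⟨c, hc, hp, hck⟩ := Nat.find_spec hex
  have hmin := fun m => Nat.find_min hex (m := m)
  set p := Nat.find hex
  have hopt : ∀ l ∈ Z, meanWeight W l ≤ meanWeight W (edgeCount c p) :=
    fun l hl => (hkmax' l hl).trans hck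
  have hsimple : IsSimpleEdgeCycle s t c p := by
    by_contra hs
    obtain ⟨γ₁, γ₂, q₁, q₂, h1, h2, hq, hsum⟩ := hc.exists_split hs
    have p1 := h1.pos
    have p2 := h2.pos
    have key : ∀ γ q, IsEdgeCycle s t γ q → q < p →
        (∑ i ∈ Finset.range q, W (γ i)) < q * meanWeight W k := by
      intro γ q h hqp
      have := hmin q hqp
      push Not at this
      have := this γ h (by omega)
      rw [meanWeight_edgeCount, div_lt_iff₀ (by exact_mod_cast h.pos)] at this
      linarith
    have k1 := key γ₁ q₁ h1 (by omega)
    have k2 := key γ₂ q₂ h2 (by omega)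
    rw [meanWeight_edgeCount, le_div_iff₀ (by exact_mod_cast hc.pos), hsum] at hck
    have : (p : ℝ) = q₁ + q₂ := by exact_mod_cast hq.symm
    rw [this] at hck
    linarith
  refine ⟨c, p, hsimple, fun γ q h => ?_⟩
  -- A rival using all edges of `c` has no others. A rival missing an edge of `c` must lose by `δ`,
  -- or there is a near tie at that edge.
  by_cases hall : ∀ i < p, ∃ j < q, γ j = c i
  · exact Or.inl (IsSimpleEdgeCycle.mem_of_subset hc h hall)
  · right
    push Not at hall
    obtain ⟨i, hi, hmiss⟩ := hall
    by_contra! hlt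
    rw [← meanWeight_edgeCount, ← meanWeight_edgeCount] at hlt
    refine hW (c i) ⟨_, mem c p hc hp, _, mem γ q h.toIsEdgeCycle h.length_le,
      edgeCount_pos.2 ⟨i, hi, rfl⟩, ?_, hopt, by linarith⟩
    by_contra hpos
    obtain ⟨j, hj, hj'⟩ := edgeCount_pos.1 (Nat.pos_of_ne_zero hpos)
    exact hmiss j hj hj'

end Counts

/-! ### Measures on periodic orbits -/

section Orbit

theorem Finset.sum_range_succ_eq_of_eq {M : Type*} [AddCommMonoid M] {h : ℕ → M} {q : ℕ}
    (hq : h q = h 0) : ∑ i ∈ Finset.range q, h (i + 1) = ∑ i ∈ Finset.range q, h i := by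
  cases q with
  | zero => simp
  | succ r => rw [Finset.sum_range_succ, Finset.sum_range_succ', hq]

variable {X : Type*} [MeasurableSpace X] {T : X → X}

/-- The uniform distribution on the points `p, T p, …, T^[q - 1] p`. -/
noncomputable def orbitMeasure (T : X → X) (p : X) (q : ℕ) : Measure X :=
  (q : ENNReal)⁻¹ • ∑ i ∈ Finset.range q, Measure.dirac (T^[i] p)

theorem orbitMeasure_apply (p : X) (q : ℕ) {A : Set X} (hA : MeasurableSet A) :
    orbitMeasure T p q A = (q : ENNReal)⁻¹ * ∑ i ∈ Finset.range q, A.indicator 1 (T^[i] p) := by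
  simp [orbitMeasure, Measure.finsetSum_apply, hA]

theorem isInvariantProb_orbitMeasure (hT : Measurable T) {p : X} {q : ℕ} (hq : 0 < q)
    (hp : T^[q] p = p) : IsInvariantProb T (orbitMeasure T p q) := by
  refine ⟨⟨?_⟩, hT, ?_⟩
  · rw [orbitMeasure_apply _ _ MeasurableSet.univ]
    simp [ENNReal.inv_mul_cancel, hq.ne']
  · ext A hA
    rw [Measure.map_apply hT hA, orbitMeasure_apply _ _ (hT hA), orbitMeasure_apply _ _ hA,
      ← Finset.sum_range_succ_eq_of_eq (h := fun i => A.indicator 1 (T^[i] p)) (by simp [hp])]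
    congr 1
    refine Finset.sum_congr rfl fun i _ => ?_
    rw [Function.iterate_succ_apply']
    rfl

theorem integral_orbitMeasure {f : X → ℝ} (hf : StronglyMeasurable f) (p : X) (q : ℕ) :
    ∫ x, f x ∂(orbitMeasure T p q) = (∑ i ∈ Finset.range q, f (T^[i] p)) / q := by
  have hint : ∀ i ∈ Finset.range q, Integrable f (Measure.dirac (T^[i] p)) := fun i _ =>
    integrable_dirac' hf (by simp)
  rw [orbitMeasure, integral_smul_measure, integral_finsetSum_measure hint]
  simp only [integral_dirac' _ _ hf, ENNReal.toReal_inv, ENNReal.toReal_natCast, smul_eq_mul]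
  field_simp

theorem orbitMeasure_compl_range [MeasurableSingletonClass X] (p : X) (q : ℕ) :
    orbitMeasure T p q (range fun n : ℕ => T^[n] p)ᶜ = 0 := by
  rw [orbitMeasure_apply _ _ (countable_range _).measurableSet.compl]
  simp

/-- A periodic orbit carries only one invariant probability measure. -/
theorem IsInvariantProb.eq_orbitMeasure {ν : Measure X} (hν : IsInvariantProb T ν) {p : X} {q : ℕ}
    (hq : 0 < q) (hp : T^[q] p = p) (hsupp : ∀ᵐ x ∂ν, ∃ n : ℕ, x = T^[n] p) :
    ν = orbitMeasure T p q := by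
  have := hν.1
  ext A hA
  rw [orbitMeasure_apply _ _ hA]
  -- The number of visits to `A` during `q` steps does not depend on the starting point on the
  -- orbit; integrating this number gives `q * ν A` by invariance.
  have hshift : ∀ n, ∑ i ∈ Finset.range q, A.indicator (1 : X → ENNReal) (T^[i] (T^[n] p)) =
      ∑ i ∈ Finset.range q, A.indicator 1 (T^[i] p) := by
    intro n
    induction n with
    | zero => rfl
    | succ n ih =>
      rw [← ih, ← Finset.sum_range_succ_eq_of_eq
        (h := fun i => A.indicator (1 : X → ENNReal) (T^[i] (T^[n] p)))]
      · refine Finset.sum_congr rfl fun i _ => ?_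
        rw [Function.iterate_succ_apply', ← Function.iterate_succ_apply]
      · simp only [← Function.iterate_add_apply]
        rw [add_comm, Function.iterate_add_apply, hp, zero_add]
  have hqν : (q : ENNReal) * ν A = ∑ i ∈ Finset.range q, A.indicator 1 (T^[i] p) := by
    calc (q : ENNReal) * ν A = ∑ i ∈ Finset.range q, ∫⁻ x, A.indicator 1 (T^[i] x) ∂ν := by
          have : ∀ i, ∫⁻ x, A.indicator 1 (T^[i] x) ∂ν = ν A := fun i => by
            rw [(hν.2.iterate i).lintegral_comp (measurable_one.indicator hA),
              lintegral_indicator_one hA]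
          simp [this]
      _ = ∫⁻ x, ∑ i ∈ Finset.range q, A.indicator 1 (T^[i] x) ∂ν :=
          (lintegral_finsetSum _ fun i _ =>
            (measurable_one.indicator hA).comp (hν.2.iterate i).measurable).symm
      _ = ∫⁻ _x, ∑ i ∈ Finset.range q, A.indicator 1 (T^[i] p) ∂ν := by
          refine lintegral_congr_ae ?_
          filter_upwards [hsupp] with x hx
          obtain ⟨n, rfl⟩ := hx
          exact hshift n
      _ = _ := by simp
  rw [← hqν, ← mul_assoc, ENNReal.inv_mul_cancel (by exact_mod_cast hq.ne') (by simp), one_mul]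

/-- A criterion for a periodic orbit to carry the only maximizing measure, in terms of Birkhoff
sums. -/
theorem isUniqueMaximizing_orbitMeasure [TopologicalSpace X] [CompactSpace X] [BorelSpace X]
    [SecondCountableTopologyEither X ℝ]
    (hT : Measurable T) {g : X → ℝ} (hg : Continuous g) {p : X} {q : ℕ} (hq : 0 < q)
    (hp : T^[q] p = p) {C : Set X} (hC : MeasurableSet C)
    (horb : ∀ x, (∀ k, T^[k] x ∈ C) → ∃ n : ℕ, x = T^[n] p) {η K : ℝ} (hη : 0 < η)
    (hbirk : ∀ x N, ∑ i ∈ Finset.range N, (g (T^[i] x) -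
      (∑ i ∈ Finset.range q, g (T^[i] p)) / q + Cᶜ.indicator (fun _ => η) (T^[i] x)) ≤ K) :
    IsUniqueMaximizing T g (orbitMeasure T p q) := by
  set α := (∑ i ∈ Finset.range q, g (T^[i] p)) / q
  have hα : ∫ x, g x ∂(orbitMeasure T p q) = α := integral_orbitMeasure hg.stronglyMeasurable p q
  have hgint : ∀ ν : Measure X, IsInvariantProb T ν → Integrable g ν := by
    intro ν hν
    have := hν.1
    obtain ⟨M, hM⟩ := (isCompact_range hg.abs).bddAbove
    exact Integrable.of_bound hg.aestronglyMeasurable M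
      (Eventually.of_forall fun x => hM (mem_range_self x))
  have key : ∀ ν : Measure X, IsInvariantProb T ν → ∫ x, g x ∂ν + η * ν.real Cᶜ ≤ α := by
    intro ν hν
    have := hν.1
    set h : X → ℝ := fun x => g x - α + Cᶜ.indicator (fun _ => η) x with hh
    have i1 : Integrable (fun x => g x - α) ν := (hgint ν hν).sub (integrable_const _)
    have i2 : Integrable (Cᶜ.indicator fun _ => η) ν := (integrable_const η).indicator hC.compl
    have hint : Integrable h ν := i1.add i2
    have hval : ∫ x, h x ∂ν = ∫ x, g x ∂ν - α + η * ν.real Cᶜ := by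
      rw [hh, integral_add i1 i2, integral_sub (hgint ν hν) (integrable_const _),
        integral_indicator_const _ hC.compl]
      simp [mul_comm]
    -- Invariance turns the uniform bound on Birkhoff sums into a bound on multiples of one
    -- integral, which is therefore nonpositive.
    have hN : ∀ N : ℕ, N * ∫ x, h x ∂ν ≤ K := by
      intro N
      have hi : ∀ i, ∫ x, h (T^[i] x) ∂ν = ∫ x, h x ∂ν := by
        intro i
        have hm := hν.2.iterate i
        rw [← integral_map hm.measurable.aemeasurable (by
          rw [hm.map_eq]; exact hint.aestronglyMeasurable), hm.map_eq]
      calc N * ∫ x, h x ∂ν = ∑ i ∈ Finset.range N, ∫ x, h (T^[i] x) ∂ν := by simp [hi]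
        _ = ∫ x, ∑ i ∈ Finset.range N, h (T^[i] x) ∂ν :=
            (integral_finsetSum _ fun i _ =>
              (hν.2.iterate i).integrable_comp_of_integrable hint).symm
        _ ≤ ∫ _x, K ∂ν := by
            refine integral_mono (integrable_finsetSum _ fun i _ =>
              (hν.2.iterate i).integrable_comp_of_integrable hint) (integrable_const _) ?_
            exact fun x => hbirk x N
        _ = K := by simp
    have hnonpos : ∫ x, h x ∂ν ≤ 0 := by
      by_contra! hpos
      obtain ⟨N, hN'⟩ := exists_nat_gt (K / ∫ x, h x ∂ν)
      rw [div_lt_iff₀ hpos] at hN'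
      exact absurd (hN N) (not_le.2 hN')
    linarith
  have hinv := isInvariantProb_orbitMeasure hT hq hp
  refine ⟨⟨hinv, fun ν hν => ?_⟩, fun ν hν => ?_⟩
  · rw [hα]
    have := key ν hν
    have : 0 ≤ η * ν.real Cᶜ := mul_nonneg hη.le measureReal_nonneg
    linarith
  · refine hν.1.eq_orbitMeasure hq hp ?_
    have := hν.1.1
    have h1 := key ν hν.1
    have h2 := hν.2 _ hinv
    rw [hα] at h2
    -- The penalty `η` off `C` leaves a maximizing measure no mass there; by invariance almost every
    -- orbit then stays in `C` forever.
    have h3 : ν.real Cᶜ = 0 := by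
      refine le_antisymm ?_ measureReal_nonneg
      by_contra! hpos
      have := mul_pos hη hpos
      linarith
    have h4 : ∀ᵐ x ∂ν, x ∈ C := by
      rw [ae_iff]
      exact (measureReal_eq_zero_iff).1 h3
    have h5 : ∀ᵐ x ∂ν, ∀ k, T^[k] x ∈ C :=
      ae_all_iff.2 fun k => (hν.1.2.iterate k).quasiMeasurePreserving.ae h4
    filter_upwards [h5] with x hx using horb x hx

/-- Birkhoff sums of a function that is small where an orbit stays in `C` for a long time, and
negative off `C`. -/
theorem birkhoff_sum_le {X : Type*} {T : X → X} {D : X → ℝ} {C : Set X} {b : ℕ → ℝ} {B : ℝ}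
    (hB : ∀ j, ∑ k ∈ Finset.range j, b k ≤ B) (hb : ∀ k, 0 ≤ b k)
    (hout : ∀ x ∉ C, D x + B ≤ 0)
    (hin : ∀ x j, (∀ k ≤ j, T^[k] x ∈ C) → T^[j + 1] x ∉ C → D x ≤ b j)
    (hstay : ∀ x, (∀ k, T^[k] x ∈ C) → D x ≤ 0) (x : X) (N : ℕ) :
    ∑ i ∈ Finset.range N, D (T^[i] x) ≤ B := by
  have hB0 : 0 ≤ B := by simpa using hB 0
  -- The stronger claim gives an orbit with `j` steps left in `C` only the budget of those steps:
  -- the loss `B` on leaving `C` pays for everything afterwards.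
  suffices h : (∀ x, ∑ i ∈ Finset.range N, D (T^[i] x) ≤ B) ∧
      ∀ x j, (∀ k < j, T^[k] x ∈ C) → T^[j] x ∉ C →
        ∑ i ∈ Finset.range N, D (T^[i] x) ≤ ∑ k ∈ Finset.range j, b k from h.1 x
  clear x
  induction N with
  | zero =>
    refine ⟨fun x => by simpa using hB0, fun x j _ _ => ?_⟩
    simpa using Finset.sum_nonneg fun k _ => hb k
  | succ N ih =>
    have hsum : ∀ x, ∑ i ∈ Finset.range (N + 1), D (T^[i] x) =
        ∑ i ∈ Finset.range N, D (T^[i] (T x)) + D x := fun x => by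
      rw [Finset.sum_range_succ']
      rfl
    have hexit : ∀ x j, (∀ k < j, T^[k] x ∈ C) → T^[j] x ∉ C →
        ∑ i ∈ Finset.range (N + 1), D (T^[i] x) ≤ ∑ k ∈ Finset.range j, b k := by
      intro x j hj hj'
      rw [hsum]
      cases j with
      | zero =>
        have := hout x hj'
        have := ih.1 (T x)
        simp only [Finset.range_zero, Finset.sum_empty]
        linarith
      | succ j =>
        rw [Finset.sum_range_succ]
        have h1 := ih.2 (T x) j (fun k hk => hj (k + 1) (by omega)) hj'
        have h2 := hin x j (fun k hk => hj k (by omega)) hj'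
        linarith
    refine ⟨fun x => ?_, hexit⟩
    by_cases hx : ∀ k, T^[k] x ∈ C
    · rw [hsum]
      have := hstay x hx
      have := ih.1 (T x)
      linarith
    · push Not at hx
      classical
      have hfind := Nat.find_spec hx
      refine (hexit x (Nat.find hx) (fun k hk => ?_) hfind).trans (hB _)
      exact not_not.1 (Nat.find_min hx hk)

end Orbit

/-! ### Lipschitz functions -/

namespace Lip

variable {X : Type*} [MetricSpace X]

@[simp] theorem add_apply (f g : Lip X) (x : X) : (f + g) x = f x + g x := rfl

theorem continuous (f : Lip X) : Continuous f := f.toContinuousMap.continuous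

theorem abs_sub_le (f : Lip X) (x y : X) : |f x - f y| ≤ lipConst f * dist x y := by
  rcases eq_or_ne x y with rfl | hxy
  · simp
  · rw [← div_le_iff₀ (dist_pos.2 hxy)]
    exact le_ciSup f.bddAbove_lip (x, y)

theorem lipConst_le {f : Lip X} {K : ℝ} (hK : 0 ≤ K)
    (h : ∀ x y, |f x - f y| ≤ K * dist x y) : lipConst f ≤ K :=
  Real.iSup_le (fun p => div_le_of_le_mul₀ dist_nonneg hK (h p.1 p.2)) hK

theorem supNorm_le {f : Lip X} {K : ℝ} (hK : 0 ≤ K) (h : ∀ x, |f x| ≤ K) : supNorm f ≤ K :=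
  Real.iSup_le h hK

theorem lipConst_le_norm (f : Lip X) : lipConst f ≤ ‖f‖ :=
  le_add_of_nonneg_left f.supNorm_nonneg

theorem abs_sub_le_norm (f : Lip X) (x y : X) : |f x - f y| ≤ ‖f‖ * dist x y :=
  (f.abs_sub_le x y).trans (mul_le_mul_of_nonneg_right f.lipConst_le_norm dist_nonneg)

variable [CompactSpace X]

theorem abs_apply_le (f : Lip X) (x : X) : |f x| ≤ ‖f‖ :=
  (le_ciSup f.bddAbove_sup x).trans (le_add_of_nonneg_right f.lipConst_nonneg)

theorem continuous_eval (x : X) : Continuous fun f : Lip X => f x :=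
  (LipschitzWith.of_dist_le_mul (K := 1) fun f g => by
    rw [NNReal.coe_one, one_mul, dist_eq_norm f g]
    exact (f - g).abs_apply_le x).continuous

end Lip

/-- The same measure serves all nearby functions. Openness makes the complement Borel, as shyness
requires. -/
theorem isOpen_lock {X : Type*} [MetricSpace X] [CompactSpace X] [MeasurableSpace X]
    (T : X → X) : IsOpen (Lock T) := by
  rw [isOpen_iff_mem_nhds]
  rintro f ⟨ν, -, hper, hev⟩
  filter_upwards [eventually_eventually_nhds.2 hev] with g hg
  exact ⟨ν, hg.self_of_nhds, hper, hg⟩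

/-! ### Words -/

section Words

variable {n : ℕ}

/-- The initial part of a word. -/
def wordInit (e : Fin (n + 1) → Bool) : Fin n → Bool := fun i => e i.castSucc

/-- The final part of a word. -/
def wordTail (e : Fin (n + 1) → Bool) : Fin n → Bool := fun i => e i.succ

theorem exists_simple_cycle_words (n : ℕ) :
    ∃ γ q, IsSimpleEdgeCycle (wordInit (n := n)) wordTail γ q :=
  ⟨fun _ _ => false, 1, ⟨one_pos, fun _ _ => rfl, rfl⟩, fun i hi j hj _ => by omega⟩

/-- Each step slides the window by one letter, so the `j`-th letter reaches the front after `j`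
steps. A walk is thus determined by its first letters, which justifies `cyclePoint`. -/
theorem apply_zero_of_walk {γ : ℕ → Fin (n + 1) → Bool}
    (h : ∀ i, wordTail (γ i) = wordInit (γ (i + 1))) (j : ℕ) (hj : j < n + 1) (k : ℕ) :
    γ (k + j) 0 = γ k ⟨j, hj⟩ := by
  induction j generalizing k with
  | zero => rfl
  | succ j ih =>
    have h1 := congrFun (h k) ⟨j, by omega⟩
    have h2 := ih (by omega) (k + 1)
    rw [show k + (j + 1) = k + 1 + j by omega, h2]
    exact h1.symm

theorem IsEdgeCycle.periodic_walk {E V : Type*} {s t : E → V} {c : ℕ → E} {p : ℕ}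
    (h : IsEdgeCycle s t c p) (i : ℕ) : t (c (i % p)) = s (c ((i + 1) % p)) := by
  have hlt := Nat.mod_lt i h.pos
  rw [h.walk _ hlt, Nat.add_mod]
  rcases (Nat.succ_le_of_lt hlt).lt_or_eq with h1 | h1
  · have hp1 : 1 % p = 1 := Nat.mod_eq_of_lt (by omega)
    rw [hp1, Nat.mod_eq_of_lt h1]
  · have h2 : (i % p + 1 % p) % p = 0 := by
      rw [← Nat.add_mod, ← Nat.mod_add_mod, show i % p + 1 = p from h1, Nat.mod_self]
    rw [h2, ← h.closed, show i % p + 1 = p from h1]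

end Words

/-! ### Cylinders, shadowing and the locking criterion in the full shift -/

namespace FullShift

variable {a : MetricSeq} {n : ℕ}

theorem shift_iterate_apply (k : ℕ) (x : FullShift a) (i : ℕ) :
    (shift a)^[k] x i = x (i + k) := by
  induction k generalizing i with
  | zero => rfl
  | succ k ih =>
    rw [Function.iterate_succ_apply']
    change (shift a)^[k] x (i + 1) = _
    rw [ih]
    congr 1
    omega

theorem measurable_shift : Measurable (shift a) :=
  measurable_pi_lambda _ fun i => measurable_pi_apply (i + 1)

theorem dist_le_of_forall_eq {x y : FullShift a} {m : ℕ} (h : ∀ i < m, x i = y i) :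
    dist x y ≤ a.toFun (m + 1) := by
  by_cases hxy : x = y
  · rw [hxy, dist_self]
    exact (a.pos _).le
  · rw [dist_of_ne hxy]
    refine a.strictAnti.antitone (Nat.succ_le_succ ?_)
    by_contra! hlt
    exact PiNat.apply_firstDiff_ne (E := fun _ => Bool) hxy (h _ hlt)

/-- The first `n + 1` symbols of a sequence. -/
def word (n : ℕ) (x : FullShift a) : Fin (n + 1) → Bool := fun i => x i

/-- A word, extended by zeros. -/
def pad (a : MetricSeq) (e : Fin (n + 1) → Bool) : FullShift a :=
  fun i => if h : i < n + 1 then e ⟨i, h⟩ else false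

@[simp] theorem word_pad (e : Fin (n + 1) → Bool) : word n (pad a e) = e := by
  funext i
  exact dif_pos i.2

theorem continuous_word : Continuous (word n : FullShift a → _) :=
  continuous_pi fun i => continuous_apply (A := fun _ : ℕ => Bool) (i : ℕ)

theorem dist_le_of_word_eq {x y : FullShift a} (h : word n x = word n y) :
    dist x y ≤ a.toFun (n + 2) :=
  dist_le_of_forall_eq fun i hi => congrFun h ⟨i, hi⟩

theorem wordTail_word (x : FullShift a) : wordTail (word n x) = wordInit (word n (shift a x)) := rfl

/-- The periodic point that follows a closed walk. -/
def cyclePoint (a : MetricSeq) (c : ℕ → Fin (n + 1) → Bool) (p : ℕ) : FullShift a :=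
  fun i => c (i % p) 0

theorem shift_iterate_cyclePoint (c : ℕ → Fin (n + 1) → Bool) (p : ℕ) :
    (shift a)^[p] (cyclePoint a c p) = cyclePoint a c p := by
  funext i
  rw [shift_iterate_apply]
  simp [cyclePoint]

theorem word_shift_iterate_cyclePoint {c : ℕ → Fin (n + 1) → Bool} {p : ℕ}
    (h : IsEdgeCycle wordInit wordTail c p) (k : ℕ) :
    word n ((shift a)^[k] (cyclePoint a c p)) = c (k % p) := by
  funext j
  have := apply_zero_of_walk (γ := fun i => c (i % p)) h.periodic_walk j j.2 k
  simp only [word, shift_iterate_apply, cyclePoint]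
  rw [add_comm]
  exact this

/-- A point whose orbit stays on a simple closed walk for a long time is close to the periodic
orbit. -/
theorem shadowing {c : ℕ → Fin (n + 1) → Bool} {p : ℕ}
    (h : IsSimpleEdgeCycle wordInit wordTail c p) {x : FullShift a} {j i : ℕ}
    (hx : ∀ k ≤ j, ∃ l < p, c l = word n ((shift a)^[k] x)) (hi : word n x = c (i % p)) :
    ∀ m < n + 1 + j, x m = (shift a)^[i] (cyclePoint a c p) m := by
  -- The next word lies on `c` and starts where the present one ends; simplicity leaves one choice.
  have hw : ∀ k ≤ j, word n ((shift a)^[k] x) = c ((i + k) % p) := by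
    intro k hk
    induction k with
    | zero => exact hi
    | succ k ih =>
      obtain ⟨l, hl, hl'⟩ := hx (k + 1) hk
      rw [← hl']
      congr 1
      refine h.inj _ hl _ (Nat.mod_lt _ h.pos) ?_
      rw [hl', Function.iterate_succ_apply', ← wordTail_word, ih (by omega), ← add_assoc]
      exact h.periodic_walk _
  intro m hm
  -- The letter `m` is visible in the window at time `min m j`, since `m - min m j ≤ n`.
  have h1 := (hw (min m j) (min_le_right _ _)).trans
    (word_shift_iterate_cyclePoint (a := a) h.toIsEdgeCycle (i + min m j)).symm
  have h2 := congrFun h1 ⟨m - min m j, by omega⟩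
  simp only [word, shift_iterate_apply] at h2 ⊢
  rw [show m - min m j + min m j = m by omega,
    show m - min m j + (i + min m j) = m + i by omega] at h2
  exact h2

theorem exists_eq_of_forall_mem {c : ℕ → Fin (n + 1) → Bool} {p : ℕ}
    (h : IsSimpleEdgeCycle wordInit wordTail c p) {x : FullShift a} {i : ℕ}
    (hx : ∀ k, ∃ l < p, c l = word n ((shift a)^[k] x)) (hi : word n x = c (i % p)) :
    x = (shift a)^[i] (cyclePoint a c p) :=
  funext fun m => shadowing h (j := m) (fun k _ => hx k) hi m (by omega)

/-- If a simple closed walk beats all others by a margin `δ`, for the weights given by the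
function `F`, then the corresponding periodic orbit is uniquely maximizing for all functions close
to `F`. -/
theorem isUniqueMaximizing_of_dominant {F g : Lip (FullShift a)} {L M ε δ : ℝ}
    {c : ℕ → Fin (n + 1) → Bool} {p : ℕ} (hc : IsSimpleEdgeCycle wordInit wordTail c p)
    (hdom : ∀ γ q, IsSimpleEdgeCycle wordInit wordTail γ q →
      (∀ i < q, ∃ j < p, c j = γ i) ∨ (∑ i ∈ Finset.range q, F (pad a (γ i))) / q ≤
        (∑ i ∈ Finset.range p, F (pad a (c i))) / p - δ)
    (hF : ∀ x y, |F x - F y| ≤ L * dist x y) (hg : ∀ x y, |g x - g y| ≤ M * dist x y)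
    (hgF : ∀ x, |g x - F x| ≤ ε) (hL : 0 ≤ L) (hM : 0 ≤ M)
    (hsum : ∀ j, ∑ k ∈ Finset.range j, a.toFun (n + 2 + k) ≤ 2 * a.toFun (n + 2))
    (hδ : 3 * M * a.toFun (n + 2) + 2 * (ε + L * a.toFun (n + 2)) < δ) :
    IsUniqueMaximizing (shift a) g (orbitMeasure (shift a) (cyclePoint a c p) p) := by
  classical
  have hp := hc.pos
  have hp' : (0 : ℝ) < p := by exact_mod_cast hp
  set A := a.toFun (n + 2) with hA
  set τ := ε + L * A with hτ
  obtain ⟨η, hη, hηδ⟩ : ∃ η > 0, 3 * M * A + η = δ - 2 * τ :=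
    ⟨δ - 2 * τ - 3 * M * A, by linarith, by ring⟩
  set P := cyclePoint a c p with hP
  -- a point in each cylinder, chosen on the periodic orbit where possible
  have hrep : ∀ e : Fin (n + 1) → Bool, ∃ y : FullShift a, word n y = e ∧
      ∀ i < p, c i = e → y = (shift a)^[i] P := by
    intro e
    by_cases he : ∃ i < p, c i = e
    · obtain ⟨i, hi, rfl⟩ := he
      refine ⟨(shift a)^[i] P, ?_, fun j hj hji => ?_⟩
      · rw [hP, word_shift_iterate_cyclePoint hc.toIsEdgeCycle, Nat.mod_eq_of_lt hi]
      · rw [hc.edge_inj hj hi hji]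
    · exact ⟨pad a e, word_pad e, fun i hi h => (he ⟨i, hi, h⟩).elim⟩
  choose rep hrepw hrepc using hrep
  set W : (Fin (n + 1) → Bool) → ℝ := fun e => g (rep e) with hW
  set α := (∑ i ∈ Finset.range p, g ((shift a)^[i] P)) / p with hα
  -- Representatives on the periodic orbit make the weight of `c` exact; an approximation error here
  -- would accumulate along the orbit.
  have hαW : ∑ i ∈ Finset.range p, W (c i) = p * α := by
    rw [hα, mul_div_cancel₀ _ hp'.ne']
    exact Finset.sum_congr rfl fun i hi => by
      rw [hW]
      dsimp only
      rw [hrepc (c i) i (Finset.mem_range.1 hi) rfl]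
  have hWF : ∀ e, |W e - F (pad a e)| ≤ τ := by
    intro e
    have h1 := hgF (rep e)
    have h2 : |F (rep e) - F (pad a e)| ≤ L * A :=
      (hF _ _).trans (mul_le_mul_of_nonneg_left
        (dist_le_of_word_eq (by rw [hrepw, word_pad])) hL)
    have h3 : |W e - F (pad a e)| ≤ |g (rep e) - F (rep e)| + |F (rep e) - F (pad a e)| :=
      abs_sub_le _ _ _
    linarith
  set inC : Set (FullShift a) := {x | ∃ i < p, c i = word n x} with hinC
  -- Passing from `F` to `W` costs `τ` for each of the two means compared, so the margin `δ - 2 * τ`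
  -- remains. It can be added to every edge off `c` while simple cycles stay nonpositive.
  set w : (Fin (n + 1) → Bool) → ℝ :=
    fun e => W e - α + if ∃ i < p, c i = e then 0 else δ - 2 * τ with hw
  have hcyc : ∀ γ q, IsSimpleEdgeCycle wordInit wordTail γ q →
      ∑ k ∈ Finset.range q, w (γ k) ≤ 0 := by
    intro γ q hγ
    rcases hdom γ q hγ with h | h
    · rw [hγ.sum_eq_of_subset hc h w]
      have : ∀ i ∈ Finset.range p, w (c i) = W (c i) - α := fun i hi => by
        simp only [hw]
        rw [if_pos ⟨i, Finset.mem_range.1 hi, rfl⟩, add_zero]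
      rw [Finset.sum_congr rfl this, Finset.sum_sub_distrib, hαW]
      simp
    · have hq' : (0 : ℝ) < q := by exact_mod_cast hγ.pos
      rw [div_le_iff₀ hq'] at h
      have hτ0 : 0 ≤ τ := (abs_nonneg _).trans (hWF (fun _ => false))
      have h1 : ∑ i ∈ Finset.range q, W (γ i) ≤
          ∑ i ∈ Finset.range q, F (pad a (γ i)) + q * τ := by
        have : ∑ i ∈ Finset.range q, W (γ i) ≤
            ∑ i ∈ Finset.range q, (F (pad a (γ i)) + τ) :=
          Finset.sum_le_sum fun i _ => by linarith [(abs_le.1 (hWF (γ i))).2]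
        rwa [Finset.sum_add_distrib, Finset.sum_const, Finset.card_range, nsmul_eq_mul] at this
      have h2 : (∑ i ∈ Finset.range p, F (pad a (c i))) / p ≤ α + τ := by
        rw [div_le_iff₀ hp']
        have : ∑ i ∈ Finset.range p, F (pad a (c i)) ≤ ∑ i ∈ Finset.range p, (W (c i) + τ) :=
          Finset.sum_le_sum fun i _ => by linarith [(abs_le.1 (hWF (c i))).1]
        rw [Finset.sum_add_distrib, Finset.sum_const, Finset.card_range, nsmul_eq_mul, hαW] at this
        linarith
      have hMA : 0 ≤ 3 * M * A := by have := a.pos (n + 2); positivity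
      have h3 : ∑ k ∈ Finset.range q, w (γ k) ≤
          ∑ k ∈ Finset.range q, (W (γ k) + (δ - 2 * τ - α)) :=
        Finset.sum_le_sum fun k _ => by
          simp only [hw]
          split_ifs <;> linarith
      have h4 : ∑ k ∈ Finset.range q, (W (γ k) + (δ - 2 * τ - α)) =
          ∑ k ∈ Finset.range q, W (γ k) + q * (δ - 2 * τ - α) := by
        rw [Finset.sum_add_distrib, Finset.sum_const, Finset.card_range, nsmul_eq_mul]
      nlinarith
  -- As `δ - 2 * τ = 3 * M * A + η`, the function in the uniqueness criterion is `w` of the word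
  -- plus `D`. Off `C`, one `M * A` absorbs the variation of `g` in the cylinder and two pay the
  -- budget `B` in `birkhoff_sum_le`.
  set D : FullShift a → ℝ := fun x => g x - W (word n x) -
    if ∃ i < p, c i = word n x then 0 else 3 * M * A with hD
  have hgd : ∀ x y : FullShift a, ∀ r, dist x y ≤ r → g x - g y ≤ M * r := fun x y r h =>
    (le_abs_self _).trans ((hg x y).trans (mul_le_mul_of_nonneg_left h hM))
  have hDle : ∀ x N, ∑ i ∈ Finset.range N, D ((shift a)^[i] x) ≤ 2 * M * A := by
    -- Staying on `c` at times `0, …, j` forces agreement with the periodic orbit on `n + 1 + j`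
    -- symbols, hence a distance of at most `a (n + 2 + j)`.
    refine birkhoff_sum_le (C := inC) (b := fun j => M * a.toFun (n + 2 + j)) ?_ ?_ ?_ ?_ ?_
    · intro j
      rw [← Finset.mul_sum]
      nlinarith [hsum j]
    · exact fun k => mul_nonneg hM (a.pos _).le
    · intro x hx
      simp only [hD]
      rw [if_neg (show ¬ ∃ i < p, c i = word n x from hx)]
      have := hgd x (rep (word n x)) A (dist_le_of_word_eq (hrepw _).symm)
      linarith
    · intro x j hj _
      obtain ⟨i, hi, hi'⟩ : ∃ i < p, c i = word n x := hj 0 (Nat.zero_le _)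
      simp only [hD]
      rw [if_pos ⟨i, hi, hi'⟩, sub_zero, hW]
      dsimp only
      refine hgd _ _ _ ?_
      rw [hrepc _ i hi hi', show n + 2 + j = n + 1 + j + 1 by omega]
      refine dist_le_of_forall_eq (shadowing hc hj ?_)
      rw [Nat.mod_eq_of_lt hi]
      exact hi'.symm
    · intro x hx
      obtain ⟨i, hi, hi'⟩ : ∃ i < p, c i = word n x := hx 0
      simp only [hD]
      rw [if_pos ⟨i, hi, hi'⟩, sub_zero, hW]
      dsimp only
      rw [hrepc _ i hi hi', ← exists_eq_of_forall_mem hc hx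
        (by rw [Nat.mod_eq_of_lt hi]; exact hi'.symm), sub_self]
  refine isUniqueMaximizing_orbitMeasure (C := inC) (η := η)
    (K := Fintype.card (Fin n → Bool) * ∑ e, |w e| + 2 * M * A) measurable_shift g.continuous hp
    (shift_iterate_cyclePoint c p) ?_ ?_ hη ?_
  · have : IsOpen (word n ⁻¹' {e | ∃ i < p, c i = e} : Set (FullShift a)) :=
      (isOpen_discrete _).preimage continuous_word
    exact this.measurableSet
  · intro x hx
    obtain ⟨i, hi, hi'⟩ := hx 0
    exact ⟨i, exists_eq_of_forall_mem hc hx (by rw [Nat.mod_eq_of_lt hi]; exact hi'.symm)⟩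
  · intro x N
    have h1 := IsEdgeWalk.sum_le (γ := fun i => word n ((shift a)^[i] x)) (q := N) hcyc
      (fun i _ => by
        dsimp only
        rw [Function.iterate_succ_apply']
        exact wordTail_word _)
    have h2 := hDle x N
    refine le_trans (le_of_eq ?_) (add_le_add h1 h2)
    rw [← Finset.sum_add_distrib]
    refine Finset.sum_congr rfl fun i _ => ?_
    by_cases hx : ∃ l < p, c l = word n ((shift a)^[i] x)
    · have hx' : (shift a)^[i] x ∉ inCᶜ := not_not.2 hx
      simp only [hw, hD, if_pos hx, indicator_of_notMem hx']
      ring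
    · have hx' : (shift a)^[i] x ∈ inCᶜ := hx
      simp only [hw, hD, if_neg hx, indicator_of_mem hx']
      linarith

theorem mem_lock_of_no_nearTie {F : Lip (FullShift a)} {L : ℝ} (hL : 0 < L) (hF : ‖F‖ ≤ L)
    (hsum : ∀ j, ∑ k ∈ Finset.range j, a.toFun (n + 2 + k) ≤ 2 * a.toFun (n + 2))
    (htie : ∀ e, ¬ IsNearTie (cycleCounts (wordInit (n := n)) wordTail (2 ^ n))
      (10 * L * a.toFun (n + 2)) e fun e => F (pad a e)) :
    F ∈ Lock (shift a) := by
  have hcard : Fintype.card (Fin n → Bool) = 2 ^ n := by simp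
  rw [← hcard] at htie
  obtain ⟨c, p, hc, hdom⟩ := exists_dominant_cycle (exists_simple_cycle_words n) htie
  have hA := a.pos (n + 2)
  set A := a.toFun (n + 2)
  have key : ∀ g : Lip (FullShift a), ‖g - F‖ < min L (L * A / 4) →
      IsUniqueMaximizing (shift a) g (orbitMeasure (shift a) (cyclePoint a c p) p) := by
    intro g hg
    have hg1 : ‖g‖ ≤ 2 * L := by
      have := norm_add_le (g - F) F
      rw [sub_add_cancel] at this
      have := min_le_left L (L * A / 4)
      linarith
    -- These values require the margin to exceed `6 * L * A + 2.5 * L * A`, which `10 * L * A` does.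
    refine isUniqueMaximizing_of_dominant (L := L) (M := 2 * L) (ε := L * A / 4) hc hdom
      (fun x y => (F.abs_sub_le_norm x y).trans (mul_le_mul_of_nonneg_right hF dist_nonneg))
      (fun x y => (g.abs_sub_le_norm x y).trans (mul_le_mul_of_nonneg_right hg1 dist_nonneg))
      (fun x => ((g - F).abs_apply_le x).trans (hg.le.trans (min_le_right _ _))) hL.le
      (by linarith) hsum ?_
    have : 0 < L * A := mul_pos hL hA
    change 3 * (2 * L) * A + 2 * (L * A / 4 + L * A) < 10 * L * A
    nlinarith
  have hε : 0 < min L (L * A / 4) := lt_min hL (by positivity)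
  refine ⟨orbitMeasure (shift a) (cyclePoint a c p) p, key F (by simpa using hε), ?_, ?_⟩
  · exact ⟨cyclePoint a c p, ⟨p, hc.pos, shift_iterate_cyclePoint c p⟩,
      orbitMeasure_compl_range _ _⟩
  · filter_upwards [Metric.ball_mem_nhds F hε] with g hg
    rw [Metric.mem_ball, dist_eq_norm] at hg
    exact key g hg

end FullShift

/-! ### Resampling one coordinate of a product measure -/

section Resample

variable {ι : Type*} [DecidableEq ι] {X : ι → Type*} [∀ i, MeasurableSpace (X i)]
  (μ : ∀ i, Measure (X i)) [∀ i, IsProbabilityMeasure (μ i)]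

theorem measurable_update_prod (j : ι) :
    Measurable fun z : (∀ i, X i) × X j => Function.update z.1 j z.2 := by
  refine measurable_pi_lambda _ fun i => ?_
  by_cases hi : i = j
  · subst hi
    simpa using measurable_snd
  · simp only [Function.update_of_ne hi]
    exact (measurable_pi_apply i).comp measurable_fst

/-- On a box, the fresh variable supplies the factor at `j` and the old point the remaining ones. -/
theorem map_update_infinitePi (j : ι) :
    ((Measure.infinitePi μ).prod (μ j)).map
      (fun z : (∀ i, X i) × X j => Function.update z.1 j z.2) = Measure.infinitePi μ := by
  refine Measure.eq_infinitePi μ fun s t ht => ?_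
  rw [Measure.map_apply (measurable_update_prod j)
    (MeasurableSet.pi s.countable_toSet fun i _ => ht i)]
  by_cases hj : j ∈ s
  · have : (fun z : (∀ i, X i) × X j => Function.update z.1 j z.2) ⁻¹' (Set.pi s t) =
        (Set.pi (s.erase j) t) ×ˢ t j := by
      ext z
      simp only [mem_preimage, Set.mem_pi, Finset.mem_coe, mem_prod, Finset.mem_erase]
      constructor
      · refine fun h => ⟨fun i hi => ?_, by simpa using h j hj⟩
        simpa [Function.update_of_ne hi.1] using h i hi.2
      · rintro ⟨h1, h2⟩ i hi
        by_cases hij : i = j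
        · subst hij
          simpa using h2
        · simpa [Function.update_of_ne hij] using h1 i ⟨hij, hi⟩
    rw [this, Measure.prod_prod, Measure.infinitePi_pi _ fun i _ => ht i,
      Finset.prod_erase_mul _ _ hj]
  · have : (fun z : (∀ i, X i) × X j => Function.update z.1 j z.2) ⁻¹' (Set.pi s t) =
        (Set.pi s t) ×ˢ univ := by
      ext z
      simp only [mem_preimage, Set.mem_pi, Finset.mem_coe, mem_prod, mem_univ, and_true]
      refine forall₂_congr fun i hi => ?_
      rw [Function.update_of_ne (by rintro rfl; exact hj hi)]
    rw [this, Measure.prod_prod, Measure.infinitePi_pi _ fun i _ => ht i, measure_univ, mul_one]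

/-- Fubini after resampling coordinate `j`: a bound on the conditional probability, uniform in the
other coordinates, bounds the probability. -/
theorem infinitePi_le_of_forall_update_le {j : ι} {A : Set (∀ i, X i)} (hA : MeasurableSet A)
    {ε : ENNReal} (h : ∀ ω, μ j {t | Function.update ω j t ∈ A} ≤ ε) :
    Measure.infinitePi μ A ≤ ε := by
  rw [← map_update_infinitePi μ j, Measure.map_apply (measurable_update_prod j) hA,
    Measure.prod_apply (measurable_update_prod j hA)]
  calc _ ≤ ∫⁻ _ω, ε ∂(Measure.infinitePi μ) := lintegral_mono fun ω => h ω
    _ = ε := by simp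

end Resample

theorem unitInterval.volume_le_of_forall_sub_le {S : Set unitInterval} {r : ℝ}
    (h : ∀ x ∈ S, ∀ y ∈ S, (x : ℝ) ≤ y → (y : ℝ) - x ≤ r) : volume S ≤ ENNReal.ofReal r := by
  rw [unitInterval.volume_apply]
  refine (Real.volume_le_diam _).trans (Metric.ediam_le ?_)
  rintro _ ⟨x, hx, rfl⟩ _ ⟨y, hy, rfl⟩
  rw [edist_dist, Real.dist_eq]
  refine ENNReal.ofReal_le_ofReal ?_
  rcases le_total (x : ℝ) y with hxy | hxy
  · rw [abs_sub_comm, abs_of_nonneg (sub_nonneg.2 hxy)]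
    exact h x hx y hy hxy
  · rw [abs_of_nonneg (sub_nonneg.2 hxy)]
    exact h y hy x hx hxy

namespace FullShift

/-! ### Random series of cylinder functions -/

/-- The nonempty words. -/
abbrev Words : Type := Σ n : ℕ, (Fin (n + 1) → Bool)

variable {a : MetricSeq} {n : ℕ} {ρ : ℝ}

/-- Different words give distance at least `a (n + 1)`, equal ones at most `a (n + 2)`. The ratio of
the two scales drives the whole argument. -/
theorem le_dist_of_word_ne {x y : FullShift a} (h : word n x ≠ word n y) :
    a.toFun (n + 1) ≤ dist x y := by
  by_contra! hlt
  rw [dist_lt_iff] at hlt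
  exact h (funext fun i => hlt i i.2)

/-- The sum of the indicator functions of all cylinders, with coefficients `H`, rescaled. -/
noncomputable def cylinderSeries (a : MetricSeq) (ρ : ℝ) (H : Words → ℝ) (x : FullShift a) : ℝ :=
  ∑' n : ℕ, ρ ^ n * a.toFun (n + 1) * H ⟨n, word n x⟩

section Series

variable {H : Words → ℝ} {D : ℕ → ℝ}

theorem norm_cylinderSeries_term_le (hρ : 0 ≤ ρ) (hH : ∀ n e, |H ⟨n, e⟩| ≤ D n)
    (x : FullShift a) (n : ℕ) :
    ‖ρ ^ n * a.toFun (n + 1) * H ⟨n, word n x⟩‖ ≤ a.toFun 0 * (ρ ^ n * D n) := by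
  have h1 := a.pos (n + 1)
  have h2 : a.toFun (n + 1) ≤ a.toFun 0 := a.strictAnti.antitone (Nat.zero_le _)
  rw [norm_mul, norm_mul, norm_pow, Real.norm_of_nonneg hρ, Real.norm_of_nonneg h1.le,
    Real.norm_eq_abs]
  calc ρ ^ n * a.toFun (n + 1) * |H ⟨n, word n x⟩| ≤ ρ ^ n * a.toFun 0 * D n := by
        have := hH n (word n x)
        have := a.pos 0
        gcongr
    _ = _ := by ring

theorem summable_cylinderSeries (hρ : 0 ≤ ρ) (hH : ∀ n e, |H ⟨n, e⟩| ≤ D n)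
    (hD : Summable fun n => ρ ^ n * D n) (x : FullShift a) :
    Summable fun n : ℕ => ρ ^ n * a.toFun (n + 1) * H ⟨n, word n x⟩ :=
  Summable.of_norm_bounded (hD.mul_left _) (norm_cylinderSeries_term_le hρ hH x)

theorem abs_cylinderSeries_le (hρ : 0 ≤ ρ) (hH : ∀ n e, |H ⟨n, e⟩| ≤ D n)
    (hD : Summable fun n => ρ ^ n * D n) (x : FullShift a) :
    |cylinderSeries a ρ H x| ≤ a.toFun 0 * ∑' n, ρ ^ n * D n := by
  rw [← tsum_mul_left]
  exact tsum_of_norm_bounded (hD.mul_left _).hasSum (norm_cylinderSeries_term_le hρ hH x)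

/-- The `n`-th terms differ only if the words differ, and then the factor `a (n + 1)` is at most the
distance. -/
theorem abs_cylinderSeries_sub_le (hρ : 0 ≤ ρ) (hH : ∀ n e, |H ⟨n, e⟩| ≤ D n)
    (hD : Summable fun n => ρ ^ n * D n) (x y : FullShift a) :
    |cylinderSeries a ρ H x - cylinderSeries a ρ H y| ≤
      (2 * ∑' n, ρ ^ n * D n) * dist x y := by
  unfold cylinderSeries
  rw [← (summable_cylinderSeries hρ hH hD x).tsum_sub (summable_cylinderSeries hρ hH hD y),
    mul_assoc, mul_comm _ (dist x y), ← mul_assoc, ← tsum_mul_left]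
  refine (Real.norm_eq_abs _).symm.trans_le
    (tsum_of_norm_bounded (hD.mul_left _).hasSum fun n => ?_)
  have hD0 : 0 ≤ D n := (abs_nonneg _).trans (hH n fun _ => false)
  by_cases hw : word n x = word n y
  · rw [hw, sub_self, norm_zero]
    have := dist_nonneg (x := x) (y := y)
    positivity
  · have h1 := le_dist_of_word_ne hw
    have h2 : |H ⟨n, word n x⟩ - H ⟨n, word n y⟩| ≤ 2 * D n := by
      have := abs_sub (H ⟨n, word n x⟩) (H ⟨n, word n y⟩)
      linarith [hH n (word n x), hH n (word n y)]
    rw [← mul_sub, norm_mul, norm_mul, norm_pow, Real.norm_of_nonneg hρ,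
      Real.norm_of_nonneg (a.pos _).le, Real.norm_eq_abs]
    calc ρ ^ n * a.toFun (n + 1) * |H ⟨n, word n x⟩ - H ⟨n, word n y⟩|
        ≤ ρ ^ n * dist x y * (2 * D n) := by gcongr
      _ = _ := by ring

/-- A cylinder series with summable coefficients as a Lipschitz function. -/
noncomputable def cylinderSeriesLip (a : MetricSeq) (hρ : 0 ≤ ρ)
    (hH : ∀ n e, |H ⟨n, e⟩| ≤ D n) (hD : Summable fun n => ρ ^ n * D n) : Lip (FullShift a) :=
  ⟨cylinderSeries a ρ H, Real.toNNReal (2 * ∑' n, ρ ^ n * D n),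
    LipschitzWith.of_dist_le' fun x y => abs_cylinderSeries_sub_le hρ hH hD x y⟩

theorem norm_le_of_eq_cylinderSeries (hρ : 0 ≤ ρ) (hH : ∀ n e, |H ⟨n, e⟩| ≤ D n)
    (hD : Summable fun n => ρ ^ n * D n) {f : Lip (FullShift a)}
    (hf : ∀ x, f x = cylinderSeries a ρ H x) :
    ‖f‖ ≤ (a.toFun 0 + 2) * ∑' n, ρ ^ n * D n := by
  have hΓ : 0 ≤ ∑' n, ρ ^ n * D n := tsum_nonneg fun n =>
    mul_nonneg (pow_nonneg hρ n) ((abs_nonneg _).trans (hH n fun _ => false))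
  have h0 := a.pos 0
  rw [Lip.norm_def, add_mul]
  refine add_le_add (Lip.supNorm_le (by positivity) fun x => ?_)
    (Lip.lipConst_le (by positivity) fun x y => ?_)
  · rw [hf]
    exact abs_cylinderSeries_le hρ hH hD x
  · rw [hf, hf]
    exact abs_cylinderSeries_sub_le hρ hH hD x y

end Series

/-! ### The random perturbation and prevalence -/

section Noise

theorem abs_unitInterval_le (ω : Words → unitInterval) (n : ℕ) (e : Fin (n + 1) → Bool) :
    |(ω ⟨n, e⟩ : ℝ)| ≤ 1 := by
  rw [abs_of_nonneg (ω _).2.1]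
  exact (ω _).2.2

theorem summable_geometric_mul_one (hρ : ρ ∈ Ioo (0 : ℝ) 1) :
    Summable fun n : ℕ => ρ ^ n * (1 : ℝ) := by
  simpa using summable_geometric_of_lt_one hρ.1.le hρ.2

/-- The cylinder series with coefficients in the unit interval. -/
noncomputable def noise (a : MetricSeq) (hρ : ρ ∈ Ioo (0 : ℝ) 1) (ω : Words → unitInterval) :
    Lip (FullShift a) :=
  cylinderSeriesLip a (H := fun w => (ω w : ℝ)) (D := fun _ => 1) hρ.1.le
    (abs_unitInterval_le ω) (summable_geometric_mul_one hρ)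

theorem noise_apply (hρ : ρ ∈ Ioo (0 : ℝ) 1) (ω : Words → unitInterval) (x : FullShift a) :
    noise a hρ ω x = cylinderSeries a ρ (fun w => (ω w : ℝ)) x := rfl

theorem norm_noise_le (hρ : ρ ∈ Ioo (0 : ℝ) 1) (ω : Words → unitInterval) :
    ‖noise a hρ ω‖ ≤ (a.toFun 0 + 2) * ∑' n : ℕ, ρ ^ n * 1 :=
  norm_le_of_eq_cylinderSeries (H := fun w => (ω w : ℝ)) hρ.1.le (abs_unitInterval_le ω)
    (summable_geometric_mul_one hρ) fun _ => rfl

theorem noise_sub_apply (hρ : ρ ∈ Ioo (0 : ℝ) 1) (ω ω' : Words → unitInterval)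
    (x : FullShift a) :
    noise a hρ ω x - noise a hρ ω' x = cylinderSeries a ρ (fun w => (ω w : ℝ) - ω' w) x := by
  rw [noise_apply, noise_apply]
  unfold cylinderSeries
  rw [← (summable_cylinderSeries (H := fun w => (ω w : ℝ)) hρ.1.le (abs_unitInterval_le ω)
      (summable_geometric_mul_one hρ) x).tsum_sub
    (summable_cylinderSeries (H := fun w => (ω' w : ℝ)) hρ.1.le (abs_unitInterval_le ω')
      (summable_geometric_mul_one hρ) x)]
  simp only [mul_sub]

/-- The norm of a difference is at most a multiple of the sum of `ρ ^ n * D ω n`, where `D ω n` is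
the largest coefficient change at level `n`. Each term is continuous because a level has finitely
many words, and a geometric series dominates. -/
theorem continuous_noise (hρ : ρ ∈ Ioo (0 : ℝ) 1) : Continuous (noise a hρ) := by
  rw [continuous_iff_continuousAt]
  intro ω'
  set D : (Words → unitInterval) → ℕ → ℝ := fun ω n =>
    dist (fun e : Fin (n + 1) → Bool => ω ⟨n, e⟩) (fun e => ω' ⟨n, e⟩) with hDdef
  have hD1 : ∀ ω n, D ω n ≤ 1 := fun ω n => (dist_pi_le_iff zero_le_one).2 fun e => by
    rw [Subtype.dist_eq]
    exact Real.dist_le_of_mem_Icc_01 (ω _).2 (ω' _).2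
  have hterm : ∀ ω n, ‖ρ ^ n * D ω n‖ ≤ ρ ^ n * 1 := fun ω n => by
    rw [Real.norm_of_nonneg (mul_nonneg (pow_nonneg hρ.1.le n) dist_nonneg)]
    exact mul_le_mul_of_nonneg_left (hD1 ω n) (pow_nonneg hρ.1.le n)
  have hsum : ∀ ω, Summable fun n => ρ ^ n * D ω n := fun ω =>
    Summable.of_norm_bounded (summable_geometric_mul_one hρ) (hterm ω)
  have hcont : Continuous fun ω => (a.toFun 0 + 2) * ∑' n, ρ ^ n * D ω n := by
    refine continuous_const.mul (continuous_tsum (fun n => ?_) (summable_geometric_mul_one hρ)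
      fun n ω => hterm ω n)
    exact continuous_const.mul ((continuous_pi fun e => continuous_apply _).dist continuous_const)
  have h0 : (a.toFun 0 + 2) * ∑' n, ρ ^ n * D ω' n = 0 := by simp [hDdef]
  rw [ContinuousAt, tendsto_iff_norm_sub_tendsto_zero]
  refine squeeze_zero (fun _ => norm_nonneg _) (fun ω => ?_) (h0 ▸ hcont.tendsto ω')
  refine norm_le_of_eq_cylinderSeries (H := fun w => (ω w : ℝ) - ω' w) hρ.1.le (fun n e => ?_)
    (hsum ω) fun x => noise_sub_apply hρ ω ω' x
  rw [← Real.dist_eq]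
  exact dist_le_pi_dist (fun e : Fin (n + 1) → Bool => ω ⟨n, e⟩) (fun e => ω' ⟨n, e⟩) e

-- The point `pad a e'` lies in one cylinder per level, so resampling one coefficient moves a single
-- edge weight of its level, as `IsNearTie.sub_le` requires.
open Classical in
theorem noise_update_sub (hρ : ρ ∈ Ioo (0 : ℝ) 1) (ω : Words → unitInterval)
    (e e' : Fin (n + 1) → Bool) (t t' : unitInterval) :
    noise a hρ (Function.update ω ⟨n, e⟩ t') (pad a e') -
      noise a hρ (Function.update ω ⟨n, e⟩ t) (pad a e') =
      if e' = e then ρ ^ n * a.toFun (n + 1) * (t' - t) else 0 := by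
  rw [noise_sub_apply, cylinderSeries, tsum_eq_single n]
  · rw [word_pad]
    split_ifs with h
    · subst h
      simp
    · have : (⟨n, e'⟩ : Words) ≠ ⟨n, e⟩ := fun h' => h (by simpa using h')
      simp [Function.update_of_ne this]
  · intro m hm
    have : (⟨m, word m (pad a e')⟩ : Words) ≠ ⟨n, e⟩ := fun h' => hm (congrArg Sigma.fst h')
    simp [Function.update_of_ne this]

/-- The distribution of the coefficients: independent and uniform. -/
noncomputable def noiseMeasure : Measure (Words → unitInterval) :=
  Measure.infinitePi fun _ => volume

instance : IsProbabilityMeasure noiseMeasure :=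
  inferInstanceAs (IsProbabilityMeasure (Measure.infinitePi fun _ => volume))

theorem measurableSet_nearTie (hρ : ρ ∈ Ioo (0 : ℝ) 1) (f : Lip (FullShift a)) {N : ℕ} {δ : ℝ}
    (e : Fin (n + 1) → Bool) :
    MeasurableSet {ω | IsNearTie (cycleCounts (wordInit (n := n)) wordTail N) δ e
      fun e => (noise a hρ ω + f) (pad a e)} := by
  refine ((isClosed_isNearTie (finite_cycleCounts _ _ N) δ e).preimage ?_).measurableSet
  exact continuous_pi fun e' => (Lip.continuous_eval (pad a e')).comp
    ((continuous_noise hρ).add continuous_const)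

/-- With the other coefficients frozen, near ties confine the weight to an interval of length `N *
δ`; the denominator is the speed at which the coefficient moves the weight. -/
theorem noiseMeasure_nearTie_le (hρ : ρ ∈ Ioo (0 : ℝ) 1) (f : Lip (FullShift a)) {N : ℕ} {δ : ℝ}
    (e : Fin (n + 1) → Bool) :
    noiseMeasure {ω | IsNearTie (cycleCounts (wordInit (n := n)) wordTail N) δ e
      fun e => (noise a hρ ω + f) (pad a e)} ≤
      ENNReal.ofReal (N * δ / (ρ ^ n * a.toFun (n + 1))) := by
  classical
  have hc : 0 < ρ ^ n * a.toFun (n + 1) := mul_pos (pow_pos hρ.1 n) (a.pos _)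
  refine infinitePi_le_of_forall_update_le _ (j := ⟨n, e⟩) (measurableSet_nearTie hρ f e)
    fun ω => unitInterval.volume_le_of_forall_sub_le fun t ht t' ht' htt' => ?_
  have hdiff := fun e' => noise_update_sub (a := a) hρ ω e e' t t'
  have hself := hdiff e
  rw [if_pos rfl] at hself
  have := IsNearTie.sub_le (fun k hk => sum_le_of_mem_cycleCounts hk) (fun e' he' => ?_) ht ht' ?_
  · simp only [Lip.add_apply] at this
    rw [le_div_iff₀ hc]
    linarith
  · have := hdiff e'
    rw [if_neg he'] at this
    simp only [Lip.add_apply]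
    linarith
  · have := mul_nonneg hc.le (sub_nonneg.2 htt')
    simp only [Lip.add_apply]
    linarith

/-- Almost every perturbation of a given function has the locking property. -/
theorem noiseMeasure_not_mem_lock {θ : ℝ} (hρ : ρ ∈ Ioo (0 : ℝ) 1) (hθ : 0 < θ) (hθρ : 4 * θ < ρ)
    (hdecay : (fun n : ℕ => a.toFun (n + 1) / a.toFun n) =O[atTop] (fun n : ℕ => θ ^ n))
    (f : Lip (FullShift a)) :
    noiseMeasure {ω | noise a hρ ω + f ∉ Lock (shift a)} = 0 := by
  set L : ℝ := (a.toFun 0 + 2) * ∑' n : ℕ, ρ ^ n * 1 + ‖f‖ + 1 with hLdef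
  have hnoise : ∀ ω, ‖noise a hρ ω + f‖ ≤ L := fun ω => by
    have := norm_add_le (noise a hρ ω) f
    have := norm_noise_le (a := a) hρ ω
    linarith
  have hL : 0 < L := by
    have := norm_nonneg (noise a hρ fun _ => 0)
    have := norm_noise_le (a := a) hρ fun _ => 0
    have := norm_nonneg f
    linarith
  obtain ⟨K, hK⟩ := hdecay.bound
  have hratio : ∀ᶠ n in atTop, a.toFun (n + 1) / a.toFun n < 1 / 2 := by
    refine (hdecay.trans_tendsto
      (tendsto_pow_atTop_nhds_zero_of_lt_one hθ.le ?_)).eventually (gt_mem_nhds one_half_pos)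
    linarith [hρ.2]
  obtain ⟨n₀, hn₀⟩ := eventually_atTop.1 (hratio.and hK)
  have hsum : ∀ n ≥ n₀, ∀ j, ∑ k ∈ Finset.range j, a.toFun (n + 2 + k) ≤ 2 * a.toFun (n + 2) := by
    intro n hn j
    -- Keeping the tail `2 * a (n + 2 + j)` closes the induction, as each ratio is below `1 / 2`.
    have : ∑ k ∈ Finset.range j, a.toFun (n + 2 + k) + 2 * a.toFun (n + 2 + j) ≤
        2 * a.toFun (n + 2) := by
      induction j with
      | zero => simp
      | succ j ih =>
        have h := (hn₀ (n + 2 + j) (by omega)).1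
        rw [div_lt_iff₀ (a.pos _)] at h
        rw [Finset.sum_range_succ, ← add_assoc]
        linarith
    linarith [a.pos (n + 2 + j)]
  have hbound : ∀ n ≥ n₀, noiseMeasure {ω | noise a hρ ω + f ∉ Lock (shift a)} ≤
      ENNReal.ofReal (20 * L * K * θ * (4 * θ / ρ) ^ n) := by
    intro n hn
    set Z := cycleCounts (wordInit (n := n)) wordTail (2 ^ n)
    set δ := 10 * L * a.toFun (n + 2)
    set r := ((2 ^ n : ℕ) : ℝ) * δ / (ρ ^ n * a.toFun (n + 1))
    have ha1 := a.pos (n + 1)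
    have ha2 := a.pos (n + 2)
    have hρn := pow_pos hρ.1 n
    calc noiseMeasure {ω | noise a hρ ω + f ∉ Lock (shift a)}
        ≤ noiseMeasure (⋃ e, {ω | IsNearTie Z δ e fun e => (noise a hρ ω + f) (pad a e)}) := by
          refine measure_mono fun ω hω => ?_
          by_contra hno
          simp only [mem_iUnion, mem_ofPred_eq, not_exists] at hno
          exact hω (mem_lock_of_no_nearTie hL (hnoise ω) (hsum n hn) hno)
      _ ≤ ∑ e, noiseMeasure {ω | IsNearTie Z δ e fun e => (noise a hρ ω + f) (pad a e)} :=
          measure_iUnion_fintype_le _ _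
      _ ≤ ∑ _e : Fin (n + 1) → Bool, ENNReal.ofReal r :=
          Finset.sum_le_sum fun e _ => noiseMeasure_nearTie_le hρ f e
      _ = ENNReal.ofReal (2 ^ (n + 1) * r) := by
          rw [ENNReal.ofReal_mul (by positivity)]
          simp
      _ ≤ ENNReal.ofReal (20 * L * K * θ * (4 * θ / ρ) ^ n) := by
          refine ENNReal.ofReal_le_ofReal ?_
          have h := (hn₀ (n + 1) (by omega)).2
          rw [Real.norm_of_nonneg (by positivity), Real.norm_of_nonneg (by positivity)] at h
          -- The number of edges `2 ^ (n + 1)` times the cycle length bound `2 ^ n` is `2 * 4 ^ n`: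
          -- this is where `θ < 1 / 4` comes from.
          have e1 : 2 ^ (n + 1) * r =
              20 * L * (4 ^ n / ρ ^ n) * (a.toFun (n + 2) / a.toFun (n + 1)) := by
            simp only [r, δ]
            push_cast
            rw [show (4 : ℝ) ^ n = 2 ^ n * 2 ^ n by rw [← mul_pow]; norm_num]
            field_simp
            ring
          have e2 : 20 * L * K * θ * (4 * θ / ρ) ^ n =
              20 * L * (4 ^ n / ρ ^ n) * (K * θ ^ (n + 1)) := by
            rw [div_pow, mul_pow]
            ring
          rw [e1, e2]
          gcongr
  have hlim : Tendsto (fun n : ℕ => ENNReal.ofReal (20 * L * K * θ * (4 * θ / ρ) ^ n)) atTop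
      (𝓝 0) := by
    have h1 : Tendsto (fun n : ℕ => (4 * θ / ρ) ^ n) atTop (𝓝 0) :=
      tendsto_pow_atTop_nhds_zero_of_lt_one (div_nonneg (by linarith) hρ.1.le)
        ((div_lt_one hρ.1).2 hθρ)
    simpa using ENNReal.tendsto_ofReal (h1.const_mul (20 * L * K * θ))
  exact le_antisymm (ge_of_tendsto hlim (eventually_atTop.2 ⟨n₀, hbound⟩)) bot_le

theorem isPrevalent_lock {θ : ℝ} (hθ : θ ∈ Ioo (0 : ℝ) (1 / 4))
    (hdecay : (fun n : ℕ => a.toFun (n + 1) / a.toFun n) =O[atTop] (fun n : ℕ => θ ^ n)) :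
    IsPrevalent (Lock (shift a)) := by
  -- `ρ < 1` makes the noise converge; `4 * θ < ρ` keeps it strong enough for the union bound.
  obtain ⟨ρ, hθρ, hρ1⟩ := exists_between (show 4 * θ < 1 by linarith [hθ.2])
  have hρ : ρ ∈ Ioo (0 : ℝ) 1 := ⟨by linarith [hθ.1], hρ1⟩
  have hclosed : IsClosed (Lock (shift a))ᶜ := (isOpen_lock _).isClosed_compl
  have hmeas : Measurable (noise a hρ) := (continuous_noise hρ).measurable
  refine ⟨(Lock (shift a))ᶜ, ⟨hclosed.measurableSet, noiseMeasure.map (noise a hρ),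
    Measure.isProbabilityMeasure_map hmeas.aemeasurable,
    ⟨range (noise a hρ), isCompact_range (continuous_noise hρ), ?_⟩, fun v => ?_⟩, subset_rfl⟩
  · rw [Measure.map_apply hmeas (isCompact_range (continuous_noise hρ)).measurableSet.compl]
    simp [preimage_compl]
  · rw [image_add_right, Measure.map_apply hmeas
      (hclosed.preimage (continuous_add_const (-v))).measurableSet]
    exact noiseMeasure_not_mem_lock hρ hθ.1 hθρ hdecay (-v)

end Noise

end FullShift

theorem IsPrevalent.mono {V : Type*} [AddCommGroup V] [TopologicalSpace V] [MeasurableSpace V]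
    {S S' : Set V} (h : IsPrevalent S) (hS : S ⊆ S') : IsPrevalent S' := by
  obtain ⟨B, hB, hSB⟩ := h
  exact ⟨B, hB, (compl_subset_compl.2 hS).trans hSB⟩

theorem theorem1p1 (θ : ℝ) (hθ : θ ∈ Set.Ioo (0 : ℝ) (1 / 4))
    (a : ℕ → ℝ) (ha : StrictAnti a) (hpos : ∀ n, 0 < a n)
    (hdecay : (fun n : ℕ => a (n + 1) / a n) =O[Filter.atTop] (fun n : ℕ => θ ^ n)) :
    IsPrevalent {f : Lip (FullShift (MetricSeq.ofDecay a ha hpos hθ hdecay)) |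
        f.toContinuousMap ∈ PU (FullShift.shift (MetricSeq.ofDecay a ha hpos hθ hdecay))} ∧
      IsPrevalent (Lock (FullShift.shift (MetricSeq.ofDecay a ha hpos hθ hdecay))) := by
  have h : IsPrevalent (Lock (FullShift.shift (MetricSeq.ofDecay a ha hpos hθ hdecay))) :=
    FullShift.isPrevalent_lock hθ hdecay
  exact ⟨h.mono fun f ⟨ν, hν, hper, _⟩ => ⟨ν, hν, hper⟩, h⟩
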